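/- For $x,y\in\{0,1\}^n$ let $|x|$ be the Hamming weight of $x$ and let $|x\cap y|$ be the number of positions in which both strings have a one. For $n$ divisible by $4$ and a real number $\kappa>1$, put $\beta=\beta(n)=\sqrt{n/32}$. In the communication problem $\mathrm{PromisedGHD}(n,\kappa)$ Alice receives $x\in\{0,1\}^n$ and Bob receives $y\in\{0,1\}^n$ with $|x|=|y|=n/2$, and they have to distinguish, with probability at least $0.9$ on every such input pair, the case $|x\cap y|=\frac n4$ from the case $|x\cap y|\in\left[\frac n4-\frac{\kappa\beta}2,\ \frac n4-\frac\beta2\right]$; on all other inputs they may behave arbitrarily. Its quantum communication complexity is the least number of qubits sent, in both directions together, by a two-party quantum protocol that solves it, where the players may share an arbitrary finite-dimensional entangled state beforehand. Theorem. The quantum communication complexity of $\mathrm{PromisedGHD}(n,\kappa)$ is $\Omega(\sqrt n)$. That is, there is an absolute constant $c>0$ such that: (i) for every $\kappa>1$ there is an $N$ such that for all $n\ge N$ divisible by $4$, the quantum communication complexity of $\mathrm{PromisedGHD}(n,\kappa)$ is at least $c\sqrt n$; (ii) more precisely, the bound $c\sqrt n$ holds for all $n$ divisible by $4$ and all $\kappa>1$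 (where $\kappa$ may depend on $n$) for which the second case of the promise occurs for at least one input pair. In particular the bound also holds for protocols without prior entanglement. -/

import Mathlib

open scoped ENNReal Matrix

noncomputable section

/-! ### Two-party quantum communication protocols with prior entanglement -/

/-- Computational basis labels of a register of `a` qubits. -/
abbrev Reg (a : ℕ) : Type := Fin a → Bool

/-- A (not necessarily normalized) joint pure state of Alice's `a` qubits and Bob's `b` qubits,
given by its amplitudes in the computational basis. -/
abbrev JointState (a b : ℕ) : Type := Reg a → Reg b → ℂ

/-- Squared norm of a joint state. -/
def JointState.normSq {a b : ℕ} (ψ : JointState a b) : ℝ :=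
  ∑ r, ∑ s, ‖ψ r s‖ ^ 2

/-- A linear isometry from `a` qubits to `c` qubits (a unitary operation that may also introduce
fresh ancilla qubits). -/
def QubitIsometry (a c : ℕ) : Type :=
  {U : Matrix (Reg c) (Reg a) ℂ // Uᴴ * U = 1}

/-- Alice applies an isometry to all her qubits. -/
def JointState.applyAlice {a b c : ℕ} (U : QubitIsometry a c) (ψ : JointState a b) :
    JointState c b :=
  fun r s => ∑ r', U.1 r r' * ψ r' s

/-- Bob applies an isometry to all his qubits. -/
def JointState.applyBob {a b c : ℕ} (V : QubitIsometry b c) (ψ : JointState a b) :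
    JointState a c :=
  fun r s => ∑ s', V.1 s s' * ψ r s'

/-- Alice's first qubit is handed over to Bob and becomes Bob's first qubit. -/
def JointState.aliceToBob {a b : ℕ} (ψ : JointState (a + 1) b) : JointState a (b + 1) :=
  fun r s => ψ (Fin.cons (s 0) r) (Fin.tail s)

/-- Bob's first qubit is handed over to Alice and becomes Alice's first qubit. -/
def JointState.bobToAlice {a b : ℕ} (ψ : JointState a (b + 1)) : JointState (a + 1) b :=
  fun r s => ψ (Fin.tail r) (Fin.cons (r 0) s)

/-- Probability of obtaining `v` when Alice's first qubit is measured in the computational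
basis. -/
def JointState.probAlice {a b : ℕ} (ψ : JointState (a + 1) b) (v : Bool) : ℝ :=
  ∑ r : Reg a, ∑ s, ‖ψ (Fin.cons v r) s‖ ^ 2

/-- Probability of obtaining `v` when Bob's first qubit is measured in the computational basis. -/
def JointState.probBob {a b : ℕ} (ψ : JointState a (b + 1)) (v : Bool) : ℝ :=
  ∑ r, ∑ s : Reg b, ‖ψ r (Fin.cons v s)‖ ^ 2

/-- The interactive part of a quantum protocol, at a moment when Alice holds `a` qubits and Bob
holds `b` qubits. Alice's operations depend on her input `x : X`, Bob's on his input `y : Y`.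
In each step one of the players applies an isometry to his or her own qubits and then either sends
one of them to the other player, or measures one of them and announces the result as the output
(the other player need not know it). -/
inductive QProtocol (X Y : Type) : ℕ → ℕ → Type
  | aliceOutput {a b : ℕ} (a' : ℕ) (U : X → QubitIsometry a (a' + 1)) : QProtocol X Y a b
  | bobOutput {a b : ℕ} (b' : ℕ) (V : Y → QubitIsometry b (b' + 1)) : QProtocol X Y a b
  | aliceSend {a b : ℕ} (a' : ℕ) (U : X → QubitIsometry a (a' + 1))
      (next : QProtocol X Y a' (b + 1)) : QProtocol X Y a b
  | bobSend {a b : ℕ} (b' : ℕ) (V : Y → QubitIsometry b (b' + 1))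
      (next : QProtocol X Y (a + 1) b') : QProtocol X Y a b

namespace QProtocol

variable {X Y : Type}

/-- The number of qubits sent, in both directions together. -/
def cost : {a b : ℕ} → QProtocol X Y a b → ℕ
  | _, _, aliceOutput _ _ => 0
  | _, _, bobOutput _ _ => 0
  | _, _, aliceSend _ _ next => next.cost + 1
  | _, _, bobSend _ _ next => next.cost + 1

/-- The probability that the protocol, started in the joint state `ψ` on inputs `x` and `y`,
outputs `v`. -/
def outputProb (x : X) (y : Y) (v : Bool) :
    {a b : ℕ} → QProtocol X Y a b → JointState a b → ℝ
  | _, _, aliceOutput _ U, ψ => (ψ.applyAlice (U x)).probAlice v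
  | _, _, bobOutput _ V, ψ => (ψ.applyBob (V y)).probBob v
  | _, _, aliceSend _ U next, ψ => outputProb x y v next (ψ.applyAlice (U x)).aliceToBob
  | _, _, bobSend _ V next, ψ => outputProb x y v next (ψ.applyBob (V y)).bobToAlice

end QProtocol

/-- A quantum protocol with arbitrary prior entanglement: before receiving their inputs the players
share an arbitrary pure state of finitely many qubits. Protocols without prior entanglement are
those in which this state is a product state. -/
structure EntangledProtocol (X Y : Type) where
  /-- Number of qubits initially held by Alice. -/
  aliceQubits : ℕ
  /-- Number of qubits initially held by Bob. -/
  bobQubits : ℕ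
  /-- The shared initial state. -/
  init : JointState aliceQubits bobQubits
  /-- The initial state is a unit vector. -/
  init_normSq : init.normSq = 1
  /-- The interaction. -/
  protocol : QProtocol X Y aliceQubits bobQubits

/-- `P` computes the partial function `F` (`none` means undefined) with error at most `ε`: on every
input pair in the domain, the output is correct with probability at least `1 - ε`. On inputs outside
the domain the behaviour is arbitrary. -/
def EntangledProtocol.Computes {X Y : Type} (P : EntangledProtocol X Y)
    (F : X → Y → Option Bool) (ε : ℝ) : Prop :=
  ∀ x y v, F x y = some v → 1 - ε ≤ P.protocol.outputProb x y v P.init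

/-- The `ε`-error quantum communication complexity, with arbitrary prior entanglement, of a partial
function: the least number of qubits sent by a protocol that computes it with error `ε`. -/
def quantumCC {X Y : Type} (F : X → Y → Option Bool) (ε : ℝ) : ℕ∞ :=
  ⨅ (P : EntangledProtocol X Y) (_ : P.Computes F ε), (P.protocol.cost : ℕ∞)

/-! ### The promised gap Hamming distance problem -/

/-- Hamming weight of a bit string. -/
def hammingWeight {n : ℕ} (x : Fin n → Bool) : ℕ :=
  (Finset.univ.filter fun i => x i = true).card

/-- The number of positions in which both bit strings have a one. -/
def interCard {n : ℕ} (x y : Fin n → Bool) : ℕ :=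
  (Finset.univ.filter fun i => x i = true ∧ y i = true).card

/-- The gap parameter `β(n) = √(n/32)`. -/
def ghdBeta (n : ℕ) : ℝ := √((n : ℝ) / 32)

open Classical in
/-- The partial communication problem PromisedGHD(n, κ): for strings of weight `n/2`, answer `true`
if `|x ∩ y| = n/4` and `false` if `|x ∩ y| ∈ [n/4 - κβ/2, n/4 - β/2]`. -/
def promisedGHD (n : ℕ) (κ : ℝ) (x y : Fin n → Bool) : Option Bool :=
  if (hammingWeight x : ℝ) = n / 2 ∧ (hammingWeight y : ℝ) = n / 2 then
    if (interCard x y : ℝ) = n / 4 then some true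
    else if (interCard x y : ℝ) ∈
        Set.Icc ((n : ℝ) / 4 - κ * ghdBeta n / 2) ((n : ℝ) / 4 - ghdBeta n / 2) then some false
    else none
  else none

end

noncomputable section

/-! ### Factorization of quantum protocols -/

open scoped Matrix.Norms.L2Operator

/-! By the Yao–Kremer decomposition, the final state of a protocol that sends `q` qubits is a sum of
`2 ^ q` terms `A i x * ψ * B i y` with contractions `A i x` and `B i y`. Its squared norm, the
acceptance probability, is therefore a sum of `4 ^ q` matrices `⟪u x, w y⟫` with vectors in the unit
ball. Prior entanglement enters only through the unit vector `ψ` and costs nothing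
(`EntangledProtocol.exists_inner_eq`). It remains to find a weighting of the input pairs that
correlates well with the acceptance probabilities of every correct protocol, but poorly with each
single matrix of this form.

The weighting is a dual certificate for the fact that a bounded polynomial of low degree cannot jump
between `h - k` and `h`. An explicit divided difference gives weights on `{0, …, 2h}` that are
dominated by `+1` at `h` and `-1` at `h - k` and annihilate degree at most `2 * D`, where `D` is
about `h / (11 * k)` (`exists_dual_weight`). Spread evenly over the Hamming layers of a cube, they
form a function without low-order Fourier coefficients (`sum_symmetrized_walsh_eq_zero`). By
Sherstov's pattern matrix method, composing this function with the selection of one masked bit per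
block makes its correlation with each `⟪u x, w y⟫` smaller than the trivial bound by a factor `2 ^
D` (`pattern_matrix_bound`).

Blocks and padding turn patterns into half-weight strings of length `4 * N` whose intersection is
the weight of the pattern plus `N - h`, so the layers `h` and `h - k` become intersections `N` and
`N - k`. Comparing the two correlations gives `2 ^ D ≤ 16 * 4 ^ q` (`two_pow_le_of_computes`). For
`h = N / 3` and `k = ⌈β / 2⌉`, which is of order `√n`, the degree `D` is of order `√n`, hence so is
`q`; the additive loss is absorbed by `q ≥ 1`. -/

/-- Projection of the first qubit onto the basis state `w`, after which this qubit is dropped. -/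
def dropQubit (a : ℕ) (w : Bool) : Matrix (Reg a) (Reg (a + 1)) ℂ :=
  fun r r' => if r' = Fin.cons w r then 1 else 0

theorem Matrix.l2_opNorm_le_one_of_conjTranspose_mul_self {m n : Type*} [Fintype m] [Fintype n]
    [DecidableEq m] [DecidableEq n] {A : Matrix m n ℂ} (h : Aᴴ * A = 1) : ‖A‖ ≤ 1 := by
  have h1 : ‖(1 : Matrix n n ℂ)‖ ≤ 1 := by
    rw [← Matrix.diagonal_one, Matrix.l2_opNorm_diagonal]
    exact (pi_norm_le_iff_of_nonneg zero_le_one).2 fun i => by simp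
  have h2 := Matrix.l2_opNorm_conjTranspose_mul_self A
  rw [h] at h2
  nlinarith [norm_nonneg A]

theorem Matrix.l2_opNorm_le_one_of_mul_conjTranspose_self {m n : Type*} [Fintype m] [Fintype n]
    [DecidableEq m] [DecidableEq n] {A : Matrix m n ℂ} (h : A * Aᴴ = 1) : ‖A‖ ≤ 1 := by
  rw [← Matrix.l2_opNorm_conjTranspose]
  exact Matrix.l2_opNorm_le_one_of_conjTranspose_mul_self (by simpa using h)

theorem Matrix.l2_opNorm_mul_le_one {l m n : Type*} [Fintype l] [Fintype m] [Fintype n]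
    [DecidableEq l] [DecidableEq m] [DecidableEq n] {A : Matrix l m ℂ} {B : Matrix m n ℂ}
    (hA : ‖A‖ ≤ 1) (hB : ‖B‖ ≤ 1) : ‖A * B‖ ≤ 1 :=
  (Matrix.l2_opNorm_mul A B).trans (mul_le_one₀ hA (norm_nonneg _) hB)

theorem dropQubit_mul_conjTranspose (a : ℕ) (w : Bool) :
    dropQubit a w * (dropQubit a w)ᴴ = 1 := by
  ext r s
  simp [Matrix.mul_apply, dropQubit, Matrix.one_apply, Matrix.conjTranspose_apply, eq_comm]

theorem norm_dropQubit_le (a : ℕ) (w : Bool) : ‖dropQubit a w‖ ≤ 1 :=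
  Matrix.l2_opNorm_le_one_of_mul_conjTranspose_self (dropQubit_mul_conjTranspose a w)

theorem norm_dropQubit_conjTranspose_le (a : ℕ) (w : Bool) : ‖(dropQubit a w)ᴴ‖ ≤ 1 := by
  rw [Matrix.l2_opNorm_conjTranspose]
  exact norm_dropQubit_le a w

/-- The matrix of an isometry. -/
def QubitIsometry.mat {a c : ℕ} (U : QubitIsometry a c) : Matrix (Reg c) (Reg a) ℂ := U.1

theorem QubitIsometry.norm_le {a c : ℕ} (U : QubitIsometry a c) : ‖U.mat‖ ≤ 1 :=
  Matrix.l2_opNorm_le_one_of_conjTranspose_mul_self U.2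

theorem QubitIsometry.norm_transpose_le {a c : ℕ} (U : QubitIsometry a c) : ‖U.matᵀ‖ ≤ 1 := by
  apply Matrix.l2_opNorm_le_one_of_mul_conjTranspose_self
  have h := congrArg Matrix.transpose U.2
  rw [Matrix.transpose_mul, Matrix.transpose_one] at h
  exact h

theorem JointState.applyAlice_eq {a b c : ℕ} (U : QubitIsometry a c)
    (ψ : Matrix (Reg a) (Reg b) ℂ) : JointState.applyAlice (b := b) U ψ = U.mat * ψ := rfl

theorem JointState.applyBob_eq {a b c : ℕ} (V : QubitIsometry b c)
    (ψ : Matrix (Reg a) (Reg b) ℂ) : JointState.applyBob (a := a) V ψ = ψ * V.matᵀ := by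
  ext r s
  simp [JointState.applyBob, Matrix.mul_apply, mul_comm, QubitIsometry.mat]

theorem Reg.eq_cons_iff {a : ℕ} (s : Reg (a + 1)) (w : Bool) (r : Reg a) :
    s = Fin.cons w r ↔ w = s 0 ∧ r = Fin.tail s := by
  constructor
  · rintro rfl; simp
  · rintro ⟨rfl, rfl⟩; simp

theorem dropQubit_mul_apply {a : ℕ} {n : Type*} (w : Bool) (φ : Matrix (Reg (a + 1)) n ℂ)
    (r : Reg a) (s : n) : (dropQubit a w * φ) r s = φ (Fin.cons w r) s := by
  simp [Matrix.mul_apply, dropQubit]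

theorem mul_dropQubit_apply {b : ℕ} {m : Type*} (w : Bool) (φ : Matrix m (Reg b) ℂ)
    (r : m) (s : Reg (b + 1)) :
    (φ * dropQubit b w) r s = if w = s 0 then φ r (Fin.tail s) else 0 := by
  simp only [Matrix.mul_apply, dropQubit, Reg.eq_cons_iff]
  by_cases h : w = s 0 <;> simp [h]

theorem conjTranspose_dropQubit_mul_apply {a : ℕ} {n : Type*} (w : Bool) (φ : Matrix (Reg a) n ℂ)
    (r : Reg (a + 1)) (s : n) :
    ((dropQubit a w)ᴴ * φ) r s = if w = r 0 then φ (Fin.tail r) s else 0 := by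
  simp only [Matrix.mul_apply, dropQubit, Reg.eq_cons_iff, Matrix.conjTranspose_apply]
  by_cases h : w = r 0 <;> simp [h]

theorem mul_conjTranspose_dropQubit_apply {b : ℕ} {m : Type*} (w : Bool)
    (φ : Matrix m (Reg (b + 1)) ℂ) (r : m) (s : Reg b) :
    (φ * (dropQubit b w)ᴴ) r s = φ r (Fin.cons w s) := by
  simp [Matrix.mul_apply, dropQubit, Matrix.conjTranspose_apply]

/-- Sending a qubit is a sum over its two basis values `w`: Alice projects onto `w` and Bob appends
a fresh qubit in state `w`. Each summand is local, so every qubit sent doubles the number of terms.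
-/
theorem JointState.aliceToBob_eq {a b : ℕ} (φ : Matrix (Reg (a + 1)) (Reg b) ℂ) :
    JointState.aliceToBob φ = ∑ w, dropQubit a w * φ * dropQubit b w := by
  ext r s
  simp only [Matrix.sum_apply, mul_dropQubit_apply, dropQubit_mul_apply]
  simp [JointState.aliceToBob]

theorem JointState.bobToAlice_eq {a b : ℕ} (φ : Matrix (Reg a) (Reg (b + 1)) ℂ) :
    JointState.bobToAlice φ = ∑ w, (dropQubit a w)ᴴ * φ * (dropQubit b w)ᴴ := by
  ext r s
  simp only [Matrix.sum_apply, mul_conjTranspose_dropQubit_apply,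
    conjTranspose_dropQubit_mul_apply]
  simp [JointState.bobToAlice]

/-- The sum of the squared absolute values of the entries of a matrix. -/
def Matrix.frobSq {m n : Type*} [Fintype m] [Fintype n] (M : Matrix m n ℂ) : ℝ :=
  ∑ r, ∑ s, ‖M r s‖ ^ 2

/-- The unnormalized final state of a protocol with `q` qubits of communication is a sum of `2 ^ q`
terms, in each of which contractions of Alice and Bob act locally on the initial state. -/
theorem QProtocol.exists_factorization {X Y : Type} {a b : ℕ} (P : QProtocol X Y a b) (v : Bool) :
    ∃ (ι : Type) (_ : Fintype ι) (a' b' : ℕ) (A : ι → X → Matrix (Reg a') (Reg a) ℂ)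
      (B : ι → Y → Matrix (Reg b) (Reg b') ℂ), Fintype.card ι = 2 ^ P.cost ∧
      (∀ i x, ‖A i x‖ ≤ 1) ∧ (∀ i y, ‖B i y‖ ≤ 1) ∧
      ∀ x y (ψ : Matrix (Reg a) (Reg b) ℂ),
        P.outputProb x y v ψ = (∑ i, A i x * ψ * B i y).frobSq := by
  induction P with
  | @aliceOutput a b a' U =>
    refine ⟨Unit, inferInstance, a', b, fun _ x => dropQubit a' v * (U x).mat, fun _ _ => 1, by
      simp [QProtocol.cost], fun _ x => Matrix.l2_opNorm_mul_le_one (norm_dropQubit_le _ _)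
      (U x).norm_le, fun _ _ => Matrix.l2_opNorm_le_one_of_conjTranspose_mul_self (by simp), ?_⟩
    intro x y ψ
    have h : ∑ _ : Unit, dropQubit a' v * (U x).mat * ψ * (1 : Matrix (Reg b) (Reg b) ℂ) =
        dropQubit a' v * ((U x).mat * ψ) := by
      rw [Fintype.sum_unique, Matrix.mul_one, Matrix.mul_assoc]
    refine Eq.trans ?_ (congrArg Matrix.frobSq h.symm)
    simp only [Matrix.frobSq, dropQubit_mul_apply]
    rfl
  | @bobOutput a b b' V =>
    refine ⟨Unit, inferInstance, a, b', fun _ _ => 1, fun _ y => (V y).matᵀ * (dropQubit b' v)ᴴ, by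
      simp [QProtocol.cost], fun _ _ => Matrix.l2_opNorm_le_one_of_conjTranspose_mul_self (by simp),
      fun _ y => Matrix.l2_opNorm_mul_le_one (V y).norm_transpose_le
        (norm_dropQubit_conjTranspose_le _ _), ?_⟩
    intro x y ψ
    have h : ∑ _ : Unit, (1 : Matrix (Reg a) (Reg a) ℂ) * ψ * ((V y).matᵀ * (dropQubit b' v)ᴴ) =
        ψ * (V y).matᵀ * (dropQubit b' v)ᴴ := by
      rw [Fintype.sum_unique, Matrix.one_mul, Matrix.mul_assoc]
    refine Eq.trans ?_ (congrArg Matrix.frobSq h.symm)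
    simp only [Matrix.frobSq, mul_conjTranspose_dropQubit_apply]
    rw [← JointState.applyBob_eq]
    rfl
  | @aliceSend a b a₁ U next ih =>
    obtain ⟨ι, hι, a', b', A, B, hcard, hA, hB, h⟩ := ih
    refine ⟨ι × Bool, inferInstance, a', b', fun i x => A i.1 x * (dropQubit a₁ i.2 * (U x).mat),
      fun i y => dropQubit b i.2 * B i.1 y, by simp [QProtocol.cost, hcard, pow_succ],
      fun i x => Matrix.l2_opNorm_mul_le_one (hA _ _) (Matrix.l2_opNorm_mul_le_one
        (norm_dropQubit_le _ _) (U x).norm_le),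
      fun i y => Matrix.l2_opNorm_mul_le_one (norm_dropQubit_le _ _) (hB _ _), ?_⟩
    intro x y ψ
    change next.outputProb x y v
      (JointState.aliceToBob (JointState.applyAlice (b := b) (U x) ψ)) = _
    rw [JointState.applyAlice_eq, JointState.aliceToBob_eq, h]
    congr 1
    rw [Fintype.sum_prod_type]
    refine Finset.sum_congr rfl fun i _ => ?_
    rw [Matrix.mul_sum, Matrix.sum_mul]
    simp only [Matrix.mul_assoc]
  | @bobSend a b b₁ V next ih =>
    obtain ⟨ι, hι, a', b', A, B, hcard, hA, hB, h⟩ := ih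
    refine ⟨ι × Bool, inferInstance, a', b', fun i x => A i.1 x * (dropQubit a i.2)ᴴ,
      fun i y => (V y).matᵀ * ((dropQubit b₁ i.2)ᴴ * B i.1 y),
      by simp [QProtocol.cost, hcard, pow_succ],
      fun i x => Matrix.l2_opNorm_mul_le_one (hA _ _) (norm_dropQubit_conjTranspose_le _ _),
      fun i y => Matrix.l2_opNorm_mul_le_one (V y).norm_transpose_le (Matrix.l2_opNorm_mul_le_one
        (norm_dropQubit_conjTranspose_le _ _) (hB _ _)), ?_⟩
    intro x y ψ
    change next.outputProb x y v
      (JointState.bobToAlice (JointState.applyBob (a := a) (V y) ψ)) = _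
    rw [JointState.applyBob_eq, JointState.bobToAlice_eq, h]
    congr 1
    rw [Fintype.sum_prod_type]
    refine Finset.sum_congr rfl fun i _ => ?_
    rw [Matrix.mul_sum, Matrix.sum_mul]
    simp only [Matrix.mul_assoc]

/-- A matrix as a vector with the Euclidean (Frobenius) norm. -/
def Matrix.toVec {m n : Type*} (M : Matrix m n ℂ) : EuclideanSpace ℂ (m × n) :=
  WithLp.toLp 2 fun p => M p.1 p.2

theorem Matrix.norm_toVec_sq {m n : Type*} [Fintype m] [Fintype n] (M : Matrix m n ℂ) :
    ‖M.toVec‖ ^ 2 = ∑ r, ∑ s, ‖M r s‖ ^ 2 := by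
  rw [EuclideanSpace.norm_sq_eq, Fintype.sum_prod_type]
  rfl

/-- The operator norm bound is applied to each column separately. -/
theorem Matrix.norm_toVec_mul_le {l m n : Type*} [Fintype l] [Fintype m] [Fintype n]
    [DecidableEq l] [DecidableEq m] {A : Matrix l m ℂ} (hA : ‖A‖ ≤ 1) (M : Matrix m n ℂ) :
    ‖(A * M).toVec‖ ≤ ‖M.toVec‖ := by
  refine (sq_le_sq₀ (norm_nonneg _) (norm_nonneg _)).1 ?_
  rw [Matrix.norm_toVec_sq, Matrix.norm_toVec_sq, Finset.sum_comm,
    Finset.sum_comm (s := (Finset.univ : Finset m))]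
  refine Finset.sum_le_sum fun s _ => ?_
  have h := (Matrix.l2_opNorm_mulVec A (WithLp.toLp 2 fun j => M j s)).trans
    (mul_le_of_le_one_left (norm_nonneg _) hA)
  have h2 := pow_le_pow_left₀ (norm_nonneg _) h 2
  rw [EuclideanSpace.norm_sq_eq, EuclideanSpace.norm_sq_eq] at h2
  exact h2

theorem Matrix.norm_toVec_conjTranspose {m n : Type*} [Fintype m] [Fintype n]
    (M : Matrix m n ℂ) : ‖Mᴴ.toVec‖ = ‖M.toVec‖ := by
  refine (pow_left_inj₀ (norm_nonneg _) (norm_nonneg _) two_ne_zero).1 ?_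
  rw [Matrix.norm_toVec_sq, Matrix.norm_toVec_sq, Finset.sum_comm]
  simp [Matrix.conjTranspose_apply]

theorem Matrix.norm_toVec_mul_le' {l m n : Type*} [Fintype l] [Fintype m] [Fintype n]
    [DecidableEq m] [DecidableEq n] {B : Matrix m n ℂ} (hB : ‖B‖ ≤ 1) (M : Matrix l m ℂ) :
    ‖(M * B).toVec‖ ≤ ‖M.toVec‖ := by
  rw [← Matrix.norm_toVec_conjTranspose, Matrix.conjTranspose_mul,
    ← Matrix.norm_toVec_conjTranspose M]
  exact Matrix.norm_toVec_mul_le (by rwa [Matrix.l2_opNorm_conjTranspose]) _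

theorem Matrix.inner_toVec {m n : Type*} [Fintype m] [Fintype n] (M N : Matrix m n ℂ) :
    inner ℂ M.toVec N.toVec = (Mᴴ * N).trace := by
  simp only [Matrix.toVec, PiLp.inner_apply, Matrix.trace, Matrix.diag, Matrix.mul_apply,
    Fintype.sum_prod_type, Matrix.conjTranspose_apply, RCLike.inner_apply]
  rw [Finset.sum_comm]
  simp [mul_comm]

theorem Matrix.toVec_sum {ι m n : Type*} (s : Finset ι) (M : ι → Matrix m n ℂ) :
    (∑ i ∈ s, M i).toVec = ∑ i ∈ s, (M i).toVec := by
  ext p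
  simp [Matrix.toVec, Matrix.sum_apply]

/-- The output probabilities of a protocol with `q` qubits of communication form a sum of `4 ^ q`
matrices of the form `⟪u x, w y⟫` with vectors of norm at most one. -/
theorem EntangledProtocol.exists_inner_eq {X Y : Type} (P : EntangledProtocol X Y) (v : Bool) :
    ∃ (κ : Type) (_ : Fintype κ) (ν : Type) (_ : Fintype ν) (u : κ → X → EuclideanSpace ℂ ν)
      (w : κ → Y → EuclideanSpace ℂ ν), Fintype.card κ = 4 ^ P.protocol.cost ∧
      (∀ i x, ‖u i x‖ ≤ 1) ∧ (∀ i y, ‖w i y‖ ≤ 1) ∧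
      ∀ x y, P.protocol.outputProb x y v P.init = ∑ i, (inner ℂ (u i x) (w i y)).re := by
  obtain ⟨ι, hι, a', b', A, B, hcard, hA, hB, h⟩ := P.protocol.exists_factorization v
  let ψ : Matrix (Reg P.aliceQubits) (Reg P.bobQubits) ℂ := P.init
  have hψ : ‖ψ.toVec‖ ≤ 1 := by
    have h1 : ‖ψ.toVec‖ ^ 2 = 1 := (Matrix.norm_toVec_sq ψ).trans P.init_normSq
    nlinarith [norm_nonneg ψ.toVec]
  -- Expanding the squared norm gives the terms `tr((A i ψ B i)ᴴ A j ψ B j)`. Cyclicity of the trace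
  -- moves all `A` factors to one side of the inner product and all `B` factors to the other.
  refine ⟨ι × ι, inferInstance, Reg P.aliceQubits × Reg P.bobQubits, inferInstance,
    fun i x => ((A i.2 x)ᴴ * A i.1 x * ψ).toVec, fun i y => (ψ * (B i.2 y * (B i.1 y)ᴴ)).toVec,
    ?_, ?_, ?_, ?_⟩
  · rw [Fintype.card_prod, hcard, ← mul_pow]; norm_num
  · intro i x
    refine (Matrix.norm_toVec_mul_le (Matrix.l2_opNorm_mul_le_one ?_ (hA _ _)) ψ).trans hψ
    rw [Matrix.l2_opNorm_conjTranspose]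
    exact hA _ _
  · intro i y
    refine (Matrix.norm_toVec_mul_le' (Matrix.l2_opNorm_mul_le_one (hB _ _) ?_) ψ).trans hψ
    rw [Matrix.l2_opNorm_conjTranspose]
    exact hB _ _
  · intro x y
    rw [h x y ψ]
    have h1 : (∑ i, A i x * ψ * B i y).frobSq =
        ‖(∑ i, A i x * ψ * B i y).toVec‖ ^ 2 := (Matrix.norm_toVec_sq _).symm
    rw [h1, Matrix.toVec_sum, ← inner_self_eq_norm_sq (𝕜 := ℂ), sum_inner]
    simp only [inner_sum]
    rw [map_sum, Fintype.sum_prod_type]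
    refine Finset.sum_congr rfl fun i _ => ?_
    rw [map_sum]
    refine Finset.sum_congr rfl fun j _ => ?_
    rw [Matrix.inner_toVec, Matrix.inner_toVec]
    simp only [RCLike.re_eq_complex_re, Matrix.conjTranspose_mul, Matrix.conjTranspose_conjTranspose,
      Matrix.mul_assoc]
    rw [Matrix.trace_mul_comm]
    simp only [Matrix.mul_assoc]

/-! ### Normalization of output probabilities -/

theorem Matrix.toVec_isometry_mul {l m n : Type*} [Fintype l] [Fintype m] [Fintype n]
    [DecidableEq m] {U : Matrix l m ℂ} (hU : Uᴴ * U = 1) (M : Matrix m n ℂ) :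
    ∑ r, ∑ s, ‖(U * M) r s‖ ^ 2 = ∑ r, ∑ s, ‖M r s‖ ^ 2 := by
  have h : inner ℂ (U * M).toVec (U * M).toVec = inner ℂ M.toVec M.toVec := by
    rw [Matrix.inner_toVec, Matrix.inner_toVec, Matrix.conjTranspose_mul, Matrix.mul_assoc,
      ← Matrix.mul_assoc Uᴴ, hU, Matrix.one_mul]
  rw [inner_self_eq_norm_sq_to_K, inner_self_eq_norm_sq_to_K] at h
  rw [← Matrix.norm_toVec_sq, ← Matrix.norm_toVec_sq]
  exact_mod_cast h

theorem JointState.normSq_applyAlice {a b c : ℕ} (U : QubitIsometry a c) (ψ : JointState a b) :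
    (ψ.applyAlice U).normSq = ψ.normSq :=
  Matrix.toVec_isometry_mul U.2 ψ

theorem JointState.normSq_applyBob {a b c : ℕ} (V : QubitIsometry b c) (ψ : JointState a b) :
    (ψ.applyBob V).normSq = ψ.normSq := by
  rw [JointState.normSq, JointState.normSq, Finset.sum_comm,
    Finset.sum_comm (s := (Finset.univ : Finset (Reg a)))]
  exact Matrix.toVec_isometry_mul V.2 (Matrix.transpose ψ)

theorem Reg.sum_succ {a : ℕ} (f : Reg (a + 1) → ℝ) :
    ∑ r, f r = ∑ r, f (Fin.cons true r) + ∑ r, f (Fin.cons false r) := by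
  rw [← (Fin.consEquiv fun _ => Bool).sum_comp, Fintype.sum_prod_type, Fintype.sum_bool]
  rfl

theorem JointState.normSq_aliceToBob {a b : ℕ} (ψ : JointState (a + 1) b) :
    ψ.aliceToBob.normSq = ψ.normSq := by
  simp only [JointState.normSq, Reg.sum_succ, JointState.aliceToBob, Fin.cons_zero, Fin.tail_cons,
    Finset.sum_add_distrib]

theorem JointState.normSq_bobToAlice {a b : ℕ} (ψ : JointState a (b + 1)) :
    ψ.bobToAlice.normSq = ψ.normSq := by
  simp only [JointState.normSq, Reg.sum_succ, JointState.bobToAlice, Fin.cons_zero, Fin.tail_cons,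
    Finset.sum_add_distrib]

/-- Isometries and transfers of qubits preserve the norm. This turns a correct answer `false` into
an upper bound on the probability of `true`. -/
theorem QProtocol.outputProb_add {X Y : Type} {a b : ℕ} (P : QProtocol X Y a b) (x : X) (y : Y)
    (ψ : JointState a b) :
    P.outputProb x y true ψ + P.outputProb x y false ψ = ψ.normSq := by
  induction P with
  | aliceOutput a' U =>
    rw [← JointState.normSq_applyAlice (U x) ψ]
    simp only [QProtocol.outputProb, JointState.probAlice, JointState.normSq, Reg.sum_succ]
  | bobOutput b' V =>
    rw [← JointState.normSq_applyBob (V y) ψ]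
    simp only [QProtocol.outputProb, JointState.probBob, JointState.normSq, Reg.sum_succ,
      Finset.sum_add_distrib]
  | aliceSend a' U next ih =>
    simp only [QProtocol.outputProb]
    rw [ih, JointState.normSq_aliceToBob, JointState.normSq_applyAlice]
  | bobSend b' V next ih =>
    simp only [QProtocol.outputProb]
    rw [ih, JointState.normSq_bobToAlice, JointState.normSq_applyBob]

theorem QProtocol.outputProb_nonneg {X Y : Type} {a b : ℕ} (P : QProtocol X Y a b) (x : X) (y : Y)
    (v : Bool) (ψ : JointState a b) : 0 ≤ P.outputProb x y v ψ := by
  obtain ⟨ι, hι, a', b', A, B, -, -, -, h⟩ := P.exists_factorization v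
  rw [h x y ψ]
  exact Finset.sum_nonneg fun _ _ => Finset.sum_nonneg fun _ _ => by positivity

/-- Without communication the output depends on the input of one of the players only. -/
theorem QProtocol.outputProb_congr_of_cost_eq_zero {X Y : Type} {a b : ℕ} (P : QProtocol X Y a b)
    (hP : P.cost = 0) (v : Bool) (ψ : JointState a b) :
    (∀ x y y', P.outputProb x y v ψ = P.outputProb x y' v ψ) ∨
      ∀ x x' y, P.outputProb x y v ψ = P.outputProb x' y v ψ := by
  cases P with
  | aliceOutput a' U => exact Or.inl fun _ _ _ => rfl
  | bobOutput b' V => exact Or.inr fun _ _ _ => rfl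
  | aliceSend a' U next => simp [QProtocol.cost] at hP
  | bobSend b' V next => simp [QProtocol.cost] at hP

end

noncomputable section

/-! ### Walsh characters and the pattern matrix bound -/

/-- The Walsh character of the Boolean cube indexed by the finite set `S`. -/
def walsh {ι : Type*} (S : Finset ι) (x : ι → Bool) : ℝ :=
  ∏ i ∈ S, if x i then -1 else 1

/-- The sum factors over coordinates as `∏ (1 ± 1)`, and one disagreement makes a factor vanish. -/
theorem sum_walsh_mul_walsh {ι : Type*} [Fintype ι] [DecidableEq ι] (x y : ι → Bool) :
    ∑ S : Finset ι, walsh S x * walsh S y = if x = y then 2 ^ Fintype.card ι else 0 := by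
  simp only [walsh, ← Finset.prod_mul_distrib]
  rw [← Finset.powerset_univ, ← Finset.prod_one_add]
  split_ifs with h
  · subst h
    rw [← Finset.card_univ, ← Finset.prod_const]
    refine Finset.prod_congr rfl fun i _ => ?_
    cases x i <;> norm_num
  · obtain ⟨i, hi⟩ := Function.ne_iff.1 h
    refine Finset.prod_eq_zero (Finset.mem_univ i) ?_
    cases hx : x i <;> cases hy : y i <;> simp_all

/-- Parseval's identity for vector-valued functions on the cube. -/
theorem sum_norm_sq_walsh {ι : Type*} [Fintype ι] [DecidableEq ι] {E : Type*}
    [NormedAddCommGroup E] [InnerProductSpace ℝ E] (u : (ι → Bool) → E) :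
    ∑ S : Finset ι, ‖∑ x, walsh S x • u x‖ ^ 2 = 2 ^ Fintype.card ι * ∑ x, ‖u x‖ ^ 2 := by
  simp only [← real_inner_self_eq_norm_sq, sum_inner, inner_sum, real_inner_smul_left,
    real_inner_smul_right]
  rw [Finset.sum_comm, Finset.mul_sum]
  refine Finset.sum_congr rfl fun x _ => ?_
  rw [Finset.sum_comm]
  simp only [← mul_assoc, ← Finset.sum_mul, sum_walsh_mul_walsh, ite_mul, zero_mul]
  simp

theorem eq_sum_walsh {ι : Type*} [Fintype ι] [DecidableEq ι] (ψ : (ι → Bool) → ℝ)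
    (z : ι → Bool) :
    2 ^ Fintype.card ι * ψ z = ∑ S : Finset ι, (∑ x, ψ x * walsh S x) * walsh S z := by
  simp only [Finset.sum_mul, mul_assoc]
  rw [Finset.sum_comm]
  simp only [← Finset.mul_sum, sum_walsh_mul_walsh, mul_ite, mul_zero]
  simp [mul_comm]

/-- The positions selected by `V` in the blocks with index in `S`. -/
def selected {ι : Type*} [DecidableEq ι] (S : Finset ι) (V : ι → Bool) : Finset (ι × Bool) :=
  S.image fun i => (i, V i)

theorem mem_selected {ι : Type*} [DecidableEq ι] {S : Finset ι} {V : ι → Bool} {p : ι × Bool} :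
    p ∈ selected S V ↔ p.1 ∈ S ∧ p.2 = V p.1 := by
  obtain ⟨i, b⟩ := p
  simp only [selected, Finset.mem_image, Prod.mk.injEq]
  constructor
  · rintro ⟨j, hj, rfl, rfl⟩; exact ⟨hj, rfl⟩
  · rintro ⟨hi, rfl⟩; exact ⟨i, hi, rfl, rfl⟩

theorem image_fst_selected {ι : Type*} [DecidableEq ι] (S : Finset ι) (V : ι → Bool) :
    (selected S V).image Prod.fst = S := by
  simp [selected, Finset.image_image, Function.comp_def]

/-- Characters are multiplicative, so the dependence on Alice's `x` separates from that on Bob's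
mask `w`; only the index set `selected S V` still involves `V`. -/
theorem walsh_xor_selected {ι : Type*} [DecidableEq ι] (S : Finset ι) (V : ι → Bool)
    (x : ι × Bool → Bool) (w : ι → Bool) :
    walsh S (fun i => xor (x (i, V i)) (w i)) = walsh (selected S V) x * walsh S w := by
  rw [walsh, walsh, walsh, selected, Finset.prod_image (fun i _ j _ h => congrArg Prod.fst h),
    ← Finset.prod_mul_distrib]
  refine Finset.prod_congr rfl fun i _ => ?_
  cases x (i, V i) <;> cases w i <;> simp

/-- The set `T` determines `S` and the values of `V` on `S`, so only `V` outside `S` is free.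
Flipping `V` on an arbitrary subset of `S` gives distinct strings, which is the injection used here.
-/
theorem card_fiber_selected_mul_le {ι : Type*} [Fintype ι] [DecidableEq ι]
    (T : Finset (ι × Bool)) (d : ℕ) :
    (Finset.univ.filter fun p : (ι → Bool) × Finset ι =>
      d ≤ p.2.card ∧ selected p.2 p.1 = T).card * 2 ^ d ≤ 2 ^ Fintype.card ι := by
  set F := Finset.univ.filter fun p : (ι → Bool) × Finset ι =>
      d ≤ p.2.card ∧ selected p.2 p.1 = T with hF
  rcases F.eq_empty_or_nonempty with h0 | ⟨p₀, hp₀⟩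
  · simp [h0]
  have hmem : ∀ p ∈ F, p.2 = p₀.2 ∧ ∀ i ∈ p.2, p.1 i = p₀.1 i := by
    intro p hp
    have h1 := (Finset.mem_filter.1 hp).2.2
    have h2 := (Finset.mem_filter.1 hp₀).2.2
    have h3 : p.2 = p₀.2 := by
      rw [← image_fst_selected p.2 p.1, h1, ← h2, image_fst_selected]
    refine ⟨h3, fun i hi => ?_⟩
    have h4 : (i, p.1 i) ∈ selected p₀.2 p₀.1 := by
      rw [h2, ← h1]; exact mem_selected.2 ⟨hi, rfl⟩
    exact (mem_selected.1 h4).2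
  have hd : d ≤ p₀.2.card := (Finset.mem_filter.1 hp₀).2.1
  calc F.card * 2 ^ d ≤ F.card * 2 ^ p₀.2.card := by gcongr; norm_num
    _ = (F ×ˢ p₀.2.powerset).card := by rw [Finset.card_product, Finset.card_powerset]
    _ ≤ (Finset.univ : Finset (ι → Bool)).card := by
      refine Finset.card_le_card_of_injOn (fun q i => xor (q.1.1 i) (decide (i ∈ q.2)))
        (fun _ _ => Finset.mem_coe.2 (Finset.mem_univ _)) ?_
      rintro ⟨⟨V, S⟩, R⟩ h ⟨⟨V', S'⟩, R'⟩ h' heq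
      simp only [Finset.coe_product, Set.mem_prod, Finset.mem_coe, Finset.mem_powerset] at h h'
      obtain ⟨e1, e2⟩ := hmem _ h.1
      obtain ⟨e1', e2'⟩ := hmem _ h'.1
      simp only at e1 e2 e1' e2' heq
      subst e1 e1'
      have hV : V = V' := by
        funext i
        by_cases hi : i ∈ p₀.2
        · rw [e2 i hi, e2' i hi]
        · have := congrFun heq i
          have n1 : i ∉ R := fun hh => hi (h.2 hh)
          have n2 : i ∉ R' := fun hh => hi (h'.2 hh)
          simpa [n1, n2] using this
      subst hV
      have hR : R = R' := by
        ext i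
        have := congrFun heq i
        simpa using this
      rw [hR]
    _ = 2 ^ Fintype.card ι := by simp

theorem sum_selected_le {ι : Type*} [Fintype ι] [DecidableEq ι] (c : Finset (ι × Bool) → ℝ)
    (hc : ∀ T, 0 ≤ c T) (d : ℕ) :
    ∑ p : (ι → Bool) × Finset ι, (if d ≤ p.2.card then c (selected p.2 p.1) else 0) ≤
      2 ^ Fintype.card ι / 2 ^ d * ∑ T, c T := by
  rw [← Finset.sum_filter,
    ← Finset.sum_fiberwise (Finset.univ.filter fun p : (ι → Bool) × Finset ι => d ≤ p.2.card)
      (fun p => selected p.2 p.1), Finset.mul_sum]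
  refine Finset.sum_le_sum fun T _ => ?_
  rw [Finset.sum_congr rfl fun p hp => congrArg c (Finset.mem_filter.1 hp).2, Finset.sum_const,
    nsmul_eq_mul, Finset.filter_filter]
  refine mul_le_mul_of_nonneg_right ?_ (hc T)
  rw [le_div_iff₀ (by positivity)]
  exact_mod_cast card_fiber_selected_mul_le T d

/-- The pattern matrix bound: a function whose low-degree Fourier coefficients vanish, composed
with a selection of one position from each block, correlates weakly with matrices
`⟪u x, v V w⟫`. -/
theorem pattern_matrix_bound {ι : Type*} [Fintype ι] [DecidableEq ι] {E : Type*}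
    [NormedAddCommGroup E] [InnerProductSpace ℝ E] {ψ : (ι → Bool) → ℝ} {C : ℝ} {d : ℕ}
    (hC : ∀ S : Finset ι, |∑ z, ψ z * walsh S z| ≤ C)
    (hd : ∀ S : Finset ι, S.card < d → ∑ z, ψ z * walsh S z = 0)
    {u : (ι × Bool → Bool) → E} {v : (ι → Bool) → (ι → Bool) → E}
    (hu : ∀ x, ‖u x‖ ≤ 1) (hv : ∀ V w, ‖v V w‖ ≤ 1) :
    (∑ V, ∑ w, ∑ x, ψ (fun i => xor (x (i, V i)) (w i)) * inner ℝ (u x) (v V w)) ^ 2 ≤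
      64 ^ Fintype.card ι * C ^ 2 / 2 ^ d := by
  set t := Fintype.card ι with ht
  let a : Finset ι → ℝ := fun S => ∑ z, ψ z * walsh S z
  let U : Finset (ι × Bool) → E := fun T => ∑ x, walsh T x • u x
  let W : (ι → Bool) → Finset ι → E := fun V S => ∑ w, walsh S w • v V w
  have hC0 : 0 ≤ C := (abs_nonneg _).trans (hC ∅)
  -- Fourier inversion of `ψ`: the sums over `x` and `w` become the transforms `U` and `W`.
  have key : 2 ^ t *
      (∑ V, ∑ w, ∑ x, ψ (fun i => xor (x (i, V i)) (w i)) * inner ℝ (u x) (v V w)) =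
      ∑ p : (ι → Bool) × Finset ι, a p.2 * inner ℝ (U (selected p.2 p.1)) (W p.1 p.2) := by
    rw [Fintype.sum_prod_type, Finset.mul_sum]
    refine Finset.sum_congr rfl fun V _ => ?_
    simp only [U, W, sum_inner, inner_sum, real_inner_smul_left, real_inner_smul_right,
      Finset.mul_sum]
    rw [Finset.sum_comm]
    have e : ∀ x w, 2 ^ t * (ψ (fun i => xor (x (i, V i)) (w i)) * inner ℝ (u x) (v V w)) =
        ∑ S, a S * (walsh (selected S V) x * (walsh S w * inner ℝ (u x) (v V w))) := by
      intro x w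
      rw [← mul_assoc, ht, eq_sum_walsh, Finset.sum_mul]
      refine Finset.sum_congr rfl fun S _ => ?_
      rw [walsh_xor_selected]
      ring
    simp only [e]
    rw [Finset.sum_comm' (t' := Finset.univ) (s' := fun _ => Finset.univ) (by simp)]
    symm
    rw [Finset.sum_comm]
    refine Finset.sum_congr rfl fun x _ => ?_
    rw [Finset.sum_comm]
    exact Finset.sum_congr rfl fun y _ => Finset.sum_congr rfl fun S _ => by ring
  have hUsum : ∑ T, ‖U T‖ ^ 2 ≤ 4 ^ t * 4 ^ t := by
    rw [sum_norm_sq_walsh, Fintype.card_prod, Fintype.card_bool, mul_comm, mul_comm _ 2, pow_mul]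
    have h1 : ∑ x, ‖u x‖ ^ 2 ≤ ∑ _x : ι × Bool → Bool, (1 : ℝ) :=
      Finset.sum_le_sum fun x _ => pow_le_one₀ (norm_nonneg _) (hu x)
    have h2 : ∑ _x : ι × Bool → Bool, (1 : ℝ) = 4 ^ t := by
      simp only [Finset.sum_const, Finset.card_univ, Fintype.card_fun, Fintype.card_prod,
        Fintype.card_bool, nsmul_eq_mul, mul_one, ← ht]
      push_cast
      rw [mul_comm, pow_mul]; norm_num
    rw [h2] at h1
    norm_num
    gcongr
  have hWsum : ∑ p : (ι → Bool) × Finset ι, ‖W p.1 p.2‖ ^ 2 ≤ 8 ^ t := by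
    rw [Fintype.sum_prod_type]
    have h1 : ∀ V, ∑ S, ‖W V S‖ ^ 2 ≤ 4 ^ t := by
      intro V
      rw [sum_norm_sq_walsh]
      have h1 : ∑ x, ‖v V x‖ ^ 2 ≤ ∑ _x : ι → Bool, (1 : ℝ) :=
        Finset.sum_le_sum fun x _ => pow_le_one₀ (norm_nonneg _) (hv V x)
      have h2 : ∑ _x : ι → Bool, (1 : ℝ) = 2 ^ t := by simp [ht]
      rw [h2] at h1
      calc (2 : ℝ) ^ Fintype.card ι * _ ≤ 2 ^ t * 2 ^ t := by rw [← ht]; gcongr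
        _ = 4 ^ t := by rw [← mul_pow]; norm_num
    calc _ ≤ ∑ _V : ι → Bool, (4 : ℝ) ^ t := Finset.sum_le_sum fun V _ => h1 V
      _ = 8 ^ t := by
        simp only [Finset.sum_const, Finset.card_univ, Fintype.card_fun, Fintype.card_bool,
          nsmul_eq_mul, ← ht]
        push_cast
        rw [← mul_pow]; norm_num
  -- The gain `2 ^ d` arises here: only `S` with at least `d` elements contribute, and each `T`
  -- comes from at most `2 ^ t / 2 ^ d` such pairs `(V, S)`.
  have hAU : ∑ p : (ι → Bool) × Finset ι, (|a p.2| * ‖U (selected p.2 p.1)‖) ^ 2 ≤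
      C ^ 2 * (2 ^ t / 2 ^ d * (4 ^ t * 4 ^ t)) := by
    calc _ ≤ ∑ p : (ι → Bool) × Finset ι,
          C ^ 2 * (if d ≤ p.2.card then ‖U (selected p.2 p.1)‖ ^ 2 else 0) := by
          refine Finset.sum_le_sum fun p _ => ?_
          split_ifs with h
          · rw [mul_pow]
            gcongr
            exact hC p.2
          · simp [a, hd p.2 (not_le.1 h)]
      _ ≤ C ^ 2 * (2 ^ t / 2 ^ d * ∑ T, ‖U T‖ ^ 2) := by
          rw [← Finset.mul_sum]
          gcongr
          exact sum_selected_le (fun T => ‖U T‖ ^ 2) (fun T => by positivity) d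
      _ ≤ _ := by gcongr
  have hCS : (∑ p : (ι → Bool) × Finset ι, a p.2 * inner ℝ (U (selected p.2 p.1)) (W p.1 p.2)) ^ 2
      ≤ C ^ 2 * (2 ^ t / 2 ^ d * (4 ^ t * 4 ^ t)) * 8 ^ t := by
    calc _ ≤ (∑ p : (ι → Bool) × Finset ι,
            |a p.2| * ‖U (selected p.2 p.1)‖ * ‖W p.1 p.2‖) ^ 2 := by
          refine sq_le_sq' ?_ ?_
          · rw [← Finset.sum_neg_distrib]
            refine Finset.sum_le_sum fun p _ => (abs_le.1 ?_).1
            rw [abs_mul, mul_assoc]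
            exact mul_le_mul_of_nonneg_left (abs_real_inner_le_norm _ _) (abs_nonneg _)
          · refine Finset.sum_le_sum fun p _ => (abs_le.1 ?_).2
            rw [abs_mul, mul_assoc]
            exact mul_le_mul_of_nonneg_left (abs_real_inner_le_norm _ _) (abs_nonneg _)
      _ ≤ _ := Finset.sum_mul_sq_le_sq_mul_sq _ _ _
      _ ≤ _ := by gcongr
  rw [← key, mul_pow] at hCS
  have e : C ^ 2 * ((2 : ℝ) ^ t / 2 ^ d * (4 ^ t * 4 ^ t)) * 8 ^ t =
      (2 ^ t) ^ 2 * (64 ^ t * C ^ 2 / 2 ^ d) := by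
    have e1 : (64 : ℝ) ^ t = (2 ^ t) ^ 6 := by rw [← pow_mul, mul_comm, pow_mul]; norm_num
    have e2 : (4 : ℝ) ^ t = (2 ^ t) ^ 2 := by rw [← pow_mul, mul_comm, pow_mul]; norm_num
    have e3 : (8 : ℝ) ^ t = (2 ^ t) ^ 3 := by rw [← pow_mul, mul_comm, pow_mul]; norm_num
    rw [e1, e2, e3]
    ring
  rw [e] at hCS
  exact le_of_mul_le_mul_left hCS (by positivity)

end

noncomputable section

/-! ### Symmetrization -/

theorem card_hammingWeight_superset {t k : ℕ} (R : Finset (Fin t)) (hk : R.card ≤ k) :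
    (Finset.univ.filter fun z : Fin t → Bool => hammingWeight z = k ∧ ∀ i ∈ R, z i = true).card =
      (t - R.card).choose (k - R.card) := by
  have h : (t - R.card).choose (k - R.card) =
      (Finset.powersetCard (k - R.card) (Finset.univ \ R)).card := by
    rw [Finset.card_powersetCard, Finset.card_univ_sdiff, Fintype.card_fin]
  rw [h]
  refine Finset.card_bij' (fun z _ => (Finset.univ.filter fun i => z i = true) \ R)
    (fun B _ i => decide (i ∈ B ∪ R)) ?_ ?_ ?_ ?_
  · intro z hz
    obtain ⟨-, h1, h2⟩ := Finset.mem_filter.1 hz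
    have hsub : R ⊆ Finset.univ.filter fun i => z i = true := fun i hi => by simpa using h2 i hi
    rw [Finset.mem_powersetCard]
    refine ⟨Finset.sdiff_subset_sdiff (Finset.subset_univ _) le_rfl, ?_⟩
    rw [Finset.card_sdiff_of_subset hsub, ← h1]
    rfl
  · intro B hB
    obtain ⟨h1, h2⟩ := Finset.mem_powersetCard.1 hB
    have hdisj : Disjoint B R := Finset.disjoint_of_subset_left h1 Finset.sdiff_disjoint
    refine Finset.mem_filter.2 ⟨Finset.mem_univ _, ?_, fun i hi => by simp [hi]⟩
    have : (Finset.univ.filter fun i => decide (i ∈ B ∪ R) = true) = B ∪ R := by ext; simp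
    rw [hammingWeight, this, Finset.card_union_of_disjoint hdisj, h2]
    omega
  · intro z hz
    obtain ⟨-, h1, h2⟩ := Finset.mem_filter.1 hz
    funext i
    by_cases hi : i ∈ R
    · simp [hi, h2 i hi]
    · simp [hi]
  · intro B hB
    obtain ⟨h1, h2⟩ := Finset.mem_powersetCard.1 hB
    have hdisj : Disjoint B R := Finset.disjoint_of_subset_left h1 Finset.sdiff_disjoint
    ext i
    have : i ∈ B → i ∉ R := fun hb hr => Finset.disjoint_left.1 hdisj hb hr
    simp
    tauto

/-- In multiplied form the identity needs no assumption: for `R.card > k` both sides vanish. -/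
theorem card_hammingWeight_superset_mul {t k : ℕ} (R : Finset (Fin t)) :
    (Finset.univ.filter fun z : Fin t → Bool => hammingWeight z = k ∧ ∀ i ∈ R, z i = true).card *
      t.choose R.card = t.choose k * k.choose R.card := by
  rcases le_or_gt R.card k with h | h
  · rw [card_hammingWeight_superset R h, Nat.choose_mul h, mul_comm]
  · rw [Nat.choose_eq_zero_of_lt h, mul_zero, mul_eq_zero, Finset.card_eq_zero]
    left
    refine Finset.filter_eq_empty_iff.2 fun z _ hz => ?_
    have hsub : R ⊆ Finset.univ.filter fun i => z i = true := fun i hi => by simpa using hz.2 i hi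
    have := Finset.card_le_card hsub
    have h2 : (Finset.univ.filter fun i => z i = true).card = k := hz.1
    omega

theorem hammingWeight_le {t : ℕ} (z : Fin t → Bool) : hammingWeight z ≤ t :=
  (Finset.card_filter_le _ _).trans (by simp)

/-- The average of the monomial `∏ i ∈ R, z i` over the layer of weight `k` is `k.choose R.card /
t.choose R.card`, a polynomial in `k` of degree `R.card`. This is the link between Fourier order on
the cube and degree in one variable. -/
theorem sum_symmetrized_superset {t : ℕ} (f : ℕ → ℝ) (R : Finset (Fin t)) :
    ∑ z : Fin t → Bool, f (hammingWeight z) / t.choose (hammingWeight z) *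
        (if ∀ i ∈ R, z i = true then 1 else 0) =
      ∑ k ∈ Finset.range (t + 1), f k * ((k.choose R.card : ℝ) / t.choose R.card) := by
  rw [← Finset.sum_fiberwise_of_maps_to (t := Finset.range (t + 1)) (g := hammingWeight)
    (fun z _ => Finset.mem_range_succ_iff.2 (hammingWeight_le z))]
  refine Finset.sum_congr rfl fun k hk => ?_
  have hk' : k ≤ t := Finset.mem_range_succ_iff.1 hk
  have hR : R.card ≤ t := by simpa using Finset.card_le_univ R
  have h1 : (t.choose R.card : ℝ) ≠ 0 := by exact_mod_cast (Nat.choose_pos hR).ne'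
  have h2 : (t.choose k : ℝ) ≠ 0 := by exact_mod_cast (Nat.choose_pos hk').ne'
  have h3 : ((Finset.univ.filter fun z : Fin t → Bool =>
      hammingWeight z = k ∧ ∀ i ∈ R, z i = true).card : ℝ) * t.choose R.card =
      t.choose k * k.choose R.card := by
    exact_mod_cast card_hammingWeight_superset_mul R
  have h4 : ∑ z : Fin t → Bool with hammingWeight z = k,
      f (hammingWeight z) / t.choose (hammingWeight z) *
        (if ∀ i ∈ R, z i = true then (1 : ℝ) else 0) =
      f k / t.choose k * (Finset.univ.filter fun z : Fin t → Bool =>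
        hammingWeight z = k ∧ ∀ i ∈ R, z i = true).card := by
    rw [← Finset.filter_filter, ← Finset.sum_boole, Finset.mul_sum]
    refine Finset.sum_congr rfl fun z hz => ?_
    rw [(Finset.mem_filter.1 hz).2]
  rw [h4]
  field_simp
  linear_combination f k * h3

theorem sum_symmetrized {t : ℕ} (f : ℕ → ℝ) :
    ∑ z : Fin t → Bool, f (hammingWeight z) / t.choose (hammingWeight z) =
      ∑ k ∈ Finset.range (t + 1), f k := by
  simpa using sum_symmetrized_superset f (∅ : Finset (Fin t))

/-- Expansion of `∏ i ∈ S, (1 - 2 z i)`. -/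
theorem walsh_eq_sum {ι : Type*} [DecidableEq ι] (S : Finset ι) (z : ι → Bool) :
    walsh S z = ∑ R ∈ S.powerset, (-2) ^ R.card * (if ∀ i ∈ R, z i = true then 1 else 0) := by
  have h : walsh S z = ∏ i ∈ S, (1 + if z i = true then -2 else 0) :=
    Finset.prod_congr rfl fun i _ => by cases z i <;> norm_num
  rw [h, Finset.prod_one_add]
  refine Finset.sum_congr rfl fun R _ => ?_
  rw [Finset.prod_ite_zero, Finset.prod_const, mul_ite, mul_one, mul_zero]

/-- If a weight function on `{0, …, t}` annihilates polynomials of degree less than `d`, then its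
symmetric lift to the cube has no Fourier coefficients of order less than `d`. -/
theorem sum_symmetrized_walsh_eq_zero {t d : ℕ} {f : ℕ → ℝ}
    (hf : ∀ p : Polynomial ℝ, p.natDegree < d →
      ∑ k ∈ Finset.range (t + 1), f k * p.eval (k : ℝ) = 0)
    (S : Finset (Fin t)) (hS : S.card < d) :
    ∑ z : Fin t → Bool, f (hammingWeight z) / t.choose (hammingWeight z) * walsh S z = 0 := by
  simp only [walsh_eq_sum, Finset.mul_sum]
  rw [Finset.sum_comm]
  refine Finset.sum_eq_zero fun R hR => ?_
  have hRd : R.card < d := (Finset.card_le_card (Finset.mem_powerset.1 hR)).trans_lt hS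
  have h1 := hf (descPochhammer ℝ R.card) (by rwa [descPochhammer_natDegree])
  have h2 : ∑ k ∈ Finset.range (t + 1), f k * ((k.choose R.card : ℝ) / t.choose R.card) = 0 := by
    have h3 : ∀ k : ℕ, f k * ((k.choose R.card : ℝ) / t.choose R.card) =
        f k * (descPochhammer ℝ R.card).eval (k : ℝ) *
          ((R.card.factorial : ℝ)⁻¹ / t.choose R.card) := by
      intro k
      rw [descPochhammer_eval_eq_descFactorial, Nat.descFactorial_eq_factorial_mul_choose]
      have := Nat.factorial_ne_zero R.card
      push_cast
      field_simp
    simp only [h3]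
    rw [← Finset.sum_mul, h1, zero_mul]
  rw [← sum_symmetrized_superset] at h2
  refine Eq.trans ?_ ((congrArg ((-2 : ℝ) ^ R.card * ·) h2).trans (mul_zero _))
  simp only [Finset.mul_sum]
  exact Finset.sum_congr rfl fun z _ => by rw [mul_left_comm]; congr

theorem abs_walsh {ι : Type*} (S : Finset ι) (z : ι → Bool) : |walsh S z| = 1 := by
  rw [walsh, Finset.abs_prod]
  exact Finset.prod_eq_one fun i _ => by cases z i <;> norm_num

theorem abs_sum_symmetrized_walsh_le {t : ℕ} (f : ℕ → ℝ) (S : Finset (Fin t)) :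
    |∑ z : Fin t → Bool, f (hammingWeight z) / t.choose (hammingWeight z) * walsh S z| ≤
      ∑ k ∈ Finset.range (t + 1), |f k| := by
  rw [← sum_symmetrized (t := t) fun k => |f k|]
  refine (Finset.abs_sum_le_sum_abs _ _).trans (Finset.sum_le_sum fun z _ => ?_)
  rw [abs_mul, abs_walsh, mul_one, abs_div, Nat.abs_cast]

end

noncomputable section

/-! ### A dual polynomial concentrated on two neighbouring points -/

/-- Pairs each `r` with `-1 - r`, the reflection under which the outer nodes are symmetric. -/
theorem prod_Ico_neg {M : Type*} [CommMonoid M] (f : ℤ → M) (D : ℕ) :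
    ∏ r ∈ Finset.Ico (-D : ℤ) D, f r = ∏ m ∈ Finset.range D, f m * f (-1 - m) := by
  induction D with
  | zero => simp
  | succ D ih =>
    have h : Finset.Ico (-(D + 1 : ℕ) : ℤ) (D + 1 : ℕ) =
        insert (D : ℤ) (insert (-1 - D : ℤ) (Finset.Ico (-D : ℤ) D)) := by
      ext r; simp only [Finset.mem_Ico, Finset.mem_insert]; omega
    rw [h, Finset.prod_insert, Finset.prod_insert, ih, Finset.prod_range_succ, mul_comm (∏ _ ∈ _, _),
      mul_assoc]
    · simp
    · simp only [Finset.mem_insert, Finset.mem_Ico]; omega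

theorem sum_Ico_neg {M : Type*} [AddCommMonoid M] (f : ℤ → M) (D : ℕ) :
    ∑ r ∈ Finset.Ico (-D : ℤ) D, f r = ∑ m ∈ Finset.range D, (f m + f (-1 - m)) :=
  prod_Ico_neg (M := Multiplicative M) f D

/-- The subtracted term makes the induction telescope. -/
theorem sum_inv_odd_sq_le (D : ℕ) :
    ∑ m ∈ Finset.range (D + 1), 1 / (2 * (m : ℝ) + 1) ^ 2 ≤ 5 / 4 - 1 / (4 * ((D : ℝ) + 1)) := by
  induction D with
  | zero => norm_num
  | succ D ih =>
    rw [Finset.sum_range_succ]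
    have h : 1 / (2 * ((D + 1 : ℕ) : ℝ) + 1) ^ 2 ≤
        1 / (4 * ((D : ℝ) + 1)) - 1 / (4 * (((D + 1 : ℕ) : ℝ) + 1)) := by
      push_cast
      rw [div_sub_div _ _ (by positivity) (by positivity), div_le_div_iff₀ (by positivity)
        (by positivity)]
      nlinarith [Nat.cast_nonneg (α := ℝ) D]
    linarith

/-- A crude Wallis bound: the factor `2` suffices, and the correction `1 / (D + 1)` carries the
induction. -/
theorem prod_odd_sq_le (D : ℕ) :
    ∏ m ∈ Finset.range (D + 1), (2 * (m : ℝ) + 1) ^ 2 ≤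
      (2 - 1 / ((D : ℝ) + 1)) * (4 ^ D * ((D + 1).factorial * D.factorial)) := by
  induction D with
  | zero => norm_num
  | succ D ih =>
    rw [Finset.prod_range_succ]
    refine (mul_le_mul_of_nonneg_right ih (by positivity)).trans ?_
    have h : (2 - 1 / ((D : ℝ) + 1)) * (2 * ((D + 1 : ℕ) : ℝ) + 1) ^ 2 ≤
        (2 - 1 / (((D + 1 : ℕ) : ℝ) + 1)) * (4 * ((D + 2) * (D + 1))) := by
      push_cast
      have h1 : (0 : ℝ) < D + 1 := by positivity
      have h2 : (0 : ℝ) < D + 1 + 1 := by positivity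
      have e1 : (2 - 1 / ((D : ℝ) + 1)) = (2 * D + 1) / (D + 1) := by field_simp; ring
      have e2 : (2 - 1 / ((D : ℝ) + 1 + 1)) = (2 * D + 3) / (D + 1 + 1) := by field_simp; ring
      rw [e1, e2, div_mul_eq_mul_div, div_mul_eq_mul_div, div_le_div_iff₀ h1 h2]
      nlinarith [Nat.cast_nonneg (α := ℝ) D, pow_nonneg (Nat.cast_nonneg (α := ℝ) D) 2,
        pow_nonneg (Nat.cast_nonneg (α := ℝ) D) 3]
    have e : ((D + 1 + 1).factorial : ℝ) = (D + 2) * (D + 1).factorial := by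
      rw [Nat.factorial_succ]; push_cast; ring
    have e' : ((D + 1).factorial : ℝ) = (D + 1) * D.factorial := by
      rw [Nat.factorial_succ]; push_cast; ring
    rw [e, pow_succ]
    calc _ = ((2 - 1 / ((D : ℝ) + 1)) * (2 * ((D + 1 : ℕ) : ℝ) + 1) ^ 2) *
          (4 ^ D * ((D + 1).factorial * D.factorial)) := by ring
      _ ≤ ((2 - 1 / (((D + 1 : ℕ) : ℝ) + 1)) * (4 * ((D + 2) * (D + 1)))) *
          (4 ^ D * ((D + 1).factorial * D.factorial)) := by gcongr
      _ = _ := by rw [e']; ring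

/-- Equivalent to the maximality of the middle binomial coefficient. -/
theorem factorial_mul_factorial_ge {D a b : ℕ} (h : a + b = 2 * D + 1) :
    (D + 1).factorial * D.factorial ≤ a.factorial * b.factorial := by
  have h1 := Nat.choose_le_middle a (2 * D + 1)
  rw [show (2 * D + 1) / 2 = D by omega] at h1
  have h2 := Nat.choose_mul_factorial_mul_factorial (n := 2 * D + 1) (k := a) (by omega)
  have h3 := Nat.choose_mul_factorial_mul_factorial (n := 2 * D + 1) (k := D) (by omega)
  rw [show 2 * D + 1 - a = b by omega] at h2
  rw [show 2 * D + 1 - D = D + 1 by omega] at h3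
  have h4 : 0 < (2 * D + 1).choose D := Nat.choose_pos (by omega)
  refine Nat.le_of_mul_le_mul_left (c := (2 * D + 1).choose D) ?_ h4
  calc _ = (2 * D + 1).choose D * D.factorial * (D + 1).factorial := by ring
    _ = (2 * D + 1).choose a * a.factorial * b.factorial := by rw [h2, h3]
    _ ≤ _ := by rw [mul_assoc]; gcongr

theorem prod_Ico_sub_left (r : ℤ) (n : ℕ) :
    ∏ i ∈ Finset.Ico (r - n) r, |(r : ℝ) - i| = n.factorial := by
  induction n with
  | zero => simp
  | succ n ih =>
    have h : Finset.Ico (r - (n + 1 : ℕ)) r = insert (r - (n + 1 : ℕ)) (Finset.Ico (r - n) r) := by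
      ext i; simp only [Finset.mem_Ico, Finset.mem_insert]; omega
    rw [h, Finset.prod_insert (by simp only [Finset.mem_Ico]; omega), ih, Nat.factorial_succ]
    push_cast
    rw [sub_sub_cancel, abs_of_nonneg (by positivity)]

theorem prod_Ico_sub_right (r : ℤ) (n : ℕ) :
    ∏ i ∈ Finset.Ico (r + 1) (r + 1 + n), |(r : ℝ) - i| = n.factorial := by
  induction n with
  | zero => simp
  | succ n ih =>
    have h : Finset.Ico (r + 1) (r + 1 + (n + 1 : ℕ)) =
        insert (r + 1 + n) (Finset.Ico (r + 1) (r + 1 + n)) := by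
      ext i; simp only [Finset.mem_Ico, Finset.mem_insert]; omega
    rw [h, Finset.prod_insert (by simp), ih, Nat.factorial_succ]
    push_cast
    rw [show (r : ℝ) - (r + 1 + n) = -(n + 1) by ring, abs_neg, abs_of_nonneg (by positivity)]

theorem prod_Ico_erase_sub_ge {D : ℕ} {r : ℤ} (hr : r ∈ Finset.Ico (-(D + 1 : ℕ) : ℤ) (D + 1 : ℕ)) :
    ((D + 1).factorial * D.factorial : ℝ) ≤
      ∏ i ∈ (Finset.Ico (-(D + 1 : ℕ) : ℤ) (D + 1 : ℕ)).erase r, |(r : ℝ) - i| := by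
  obtain ⟨h1, h2⟩ := Finset.mem_Ico.1 hr
  obtain ⟨a, ha⟩ := Int.eq_ofNat_of_zero_le (show 0 ≤ r + (D + 1 : ℕ) by omega)
  obtain ⟨b, hb⟩ := Int.eq_ofNat_of_zero_le (show 0 ≤ (D : ℤ) - r by omega)
  have h : (Finset.Ico (-(D + 1 : ℕ) : ℤ) (D + 1 : ℕ)).erase r =
      Finset.Ico (r - a) r ∪ Finset.Ico (r + 1) (r + 1 + b) := by
    ext i; simp only [Finset.mem_Ico, Finset.mem_erase, Finset.mem_union]; omega
  rw [h, Finset.prod_union, prod_Ico_sub_left, prod_Ico_sub_right]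
  · exact_mod_cast factorial_mul_factorial_ge (by omega)
  · rw [Finset.disjoint_left]
    intro i; simp only [Finset.mem_Ico]; omega

/-- Outer interpolation nodes. -/
def outerNode (r : ℤ) : ℤ := 11 * r + 5

/-- Interpolation nodes: the pair `0`, `-1` and `2 * D` points in arithmetic progression. -/
def dualNodes (D : ℕ) : Finset ℤ :=
  insert 0 (insert (-1) ((Finset.Ico (-D : ℤ) D).image outerNode))

theorem outerNode_injective : Function.Injective outerNode := fun a b h => by
  simp only [outerNode] at h; omega

theorem card_dualNodes (D : ℕ) : (dualNodes D).card = 2 * D + 2 := by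
  rw [dualNodes, Finset.card_insert_of_notMem, Finset.card_insert_of_notMem,
    Finset.card_image_of_injective _ outerNode_injective, Int.card_Ico]
  · omega
  · simp only [Finset.mem_image, outerNode]; omega
  · simp only [Finset.mem_insert, Finset.mem_image, outerNode]; omega

/-- The denominators of the divided difference on the nodes `dualNodes D`. -/
def dualDenom (D : ℕ) (e : ℤ) : ℝ := ∏ i ∈ (dualNodes D).erase e, ((e : ℝ) - i)

theorem dualDenom_eq (D : ℕ) (e : ℤ) :
    dualDenom D e = (if (0 : ℤ) ≠ e then (e : ℝ) else 1) * ((if (-1 : ℤ) ≠ e then (e : ℝ) + 1 else 1) *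
      ∏ r ∈ Finset.Ico (-D : ℤ) D, if outerNode r ≠ e then (e : ℝ) - outerNode r else 1) := by
  rw [dualDenom, ← Finset.filter_ne', Finset.prod_filter, dualNodes, Finset.prod_insert,
    Finset.prod_insert, Finset.prod_image outerNode_injective.injOn]
  · simp
  · simp only [Finset.mem_image, outerNode]; omega
  · simp only [Finset.mem_insert, Finset.mem_image, outerNode]; omega

theorem dualDenom_zero (D : ℕ) :
    dualDenom D 0 = ∏ m ∈ Finset.range D, -((11 * (m : ℝ) + 5) * (11 * m + 6)) := by
  rw [dualDenom_eq, prod_Ico_neg]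
  simp only [ne_eq, not_true_eq_false, if_false, one_mul]
  rw [if_pos (by norm_num)]
  simp only [Int.cast_zero, zero_add, one_mul]
  refine Finset.prod_congr rfl fun m _ => ?_
  rw [if_pos (by simp only [outerNode]; omega), if_pos (by simp only [outerNode]; omega)]
  simp only [outerNode]
  push_cast
  ring

/-- The reflection `e ↦ -1 - e` preserves the nodes, swaps `0` and `-1`, and changes the sign of
each of the `2 * D + 1` factors, an odd number. -/
theorem dualDenom_neg_one (D : ℕ) : dualDenom D (-1) = -dualDenom D 0 := by
  rw [dualDenom_zero, dualDenom_eq, prod_Ico_neg]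
  simp only [ne_eq, not_true_eq_false, if_false, one_mul]
  rw [if_pos (by norm_num)]
  rw [Int.cast_neg, Int.cast_one, neg_one_mul]
  congr 1
  refine Finset.prod_congr rfl fun m _ => ?_
  rw [if_pos (by simp only [outerNode]; omega), if_pos (by simp only [outerNode]; omega)]
  simp only [outerNode]
  push_cast
  ring

theorem dualDenom_zero_ne_zero (D : ℕ) : dualDenom D 0 ≠ 0 := by
  rw [dualDenom_zero]
  exact Finset.prod_ne_zero_iff.2 fun m _ => neg_ne_zero.2 (by positivity)

theorem abs_dualDenom_zero_le (D : ℕ) :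
    |dualDenom (D + 1) 0| ≤
      (121 / 4) ^ (D + 1) * (2 * (4 ^ D * ((D + 1).factorial * D.factorial))) := by
  rw [dualDenom_zero, Finset.abs_prod]
  calc _ ≤ ∏ m ∈ Finset.range (D + 1), (121 / 4 * (2 * (m : ℝ) + 1) ^ 2) := by
        refine Finset.prod_le_prod (fun _ _ => abs_nonneg _) fun m _ => ?_
        rw [abs_neg, abs_of_nonneg (by positivity)]
        nlinarith
    _ = (121 / 4) ^ (D + 1) * ∏ m ∈ Finset.range (D + 1), (2 * (m : ℝ) + 1) ^ 2 := by
        rw [Finset.prod_mul_distrib, Finset.prod_const, Finset.card_range]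
    _ ≤ _ := by
        gcongr
        refine (prod_odd_sq_le D).trans ?_
        gcongr
        rw [sub_le_self_iff]
        positivity

/-- For `e = 11 * r + 5` one has `e * (e + 1) = (121 * (2 * r + 1) ^ 2 - 1) / 4`, which is at least
`30 * (2 * r + 1) ^ 2`. The remaining nodes are in arithmetic progression and contribute factorials.
-/
theorem abs_dualDenom_outerNode_ge {D : ℕ} {r : ℤ}
    (hr : r ∈ Finset.Ico (-(D + 1 : ℕ) : ℤ) (D + 1 : ℕ)) :
    30 * (2 * (r : ℝ) + 1) ^ 2 * (11 ^ (2 * D + 1) * ((D + 1).factorial * D.factorial)) ≤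
      |dualDenom (D + 1) (outerNode r)| := by
  rw [dualDenom_eq, if_pos (by simp only [outerNode]; omega),
    if_pos (by simp only [outerNode]; omega), ← mul_assoc (outerNode r : ℝ), abs_mul]
  have h1 : 30 * (2 * (r : ℝ) + 1) ^ 2 ≤ |(outerNode r : ℝ) * ((outerNode r : ℝ) + 1)| := by
    refine le_trans ?_ (le_abs_self _)
    simp only [outerNode]
    push_cast
    have : (1 : ℝ) ≤ (2 * (r : ℝ) + 1) ^ 2 := by
      have : (1 : ℤ) ≤ (2 * r + 1) ^ 2 := by
        have : 0 < (2 * r + 1) ^ 2 := by have : 2 * r + 1 ≠ 0 := by omega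
                                         positivity
        omega
      exact_mod_cast this
    nlinarith
  have h2 : |∏ i ∈ Finset.Ico (-(D + 1 : ℕ) : ℤ) (D + 1 : ℕ),
      if outerNode i ≠ outerNode r then (outerNode r : ℝ) - outerNode i else 1| =
      11 ^ (2 * D + 1) *
        ∏ i ∈ (Finset.Ico (-(D + 1 : ℕ) : ℤ) (D + 1 : ℕ)).erase r, |(r : ℝ) - i| := by
    simp only [outerNode_injective.ne_iff]
    rw [← Finset.prod_filter, Finset.filter_ne', Finset.abs_prod]
    have hc : ((Finset.Ico (-(D + 1 : ℕ) : ℤ) (D + 1 : ℕ)).erase r).card = 2 * D + 1 := by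
      rw [Finset.card_erase_of_mem hr, Int.card_Ico]; omega
    rw [← hc, ← Finset.prod_const, ← Finset.prod_mul_distrib]
    refine Finset.prod_congr rfl fun i _ => ?_
    simp only [outerNode]
    push_cast
    rw [show (11 * (r : ℝ) + 5 - (11 * i + 5)) = 11 * (r - i) by ring, abs_mul]
    norm_num
  rw [h2]
  refine mul_le_mul h1 ?_ (by positivity) (abs_nonneg _)
  gcongr
  exact prod_Ico_erase_sub_ge hr

theorem abs_dualDenom_ratio_le {D : ℕ} {r : ℤ}
    (hr : r ∈ Finset.Ico (-(D + 1 : ℕ) : ℤ) (D + 1 : ℕ)) :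
    |dualDenom (D + 1) 0 / dualDenom (D + 1) (outerNode r)| ≤
      11 / 60 * (1 / (2 * (r : ℝ) + 1) ^ 2) := by
  have hpos : (0 : ℝ) < (2 * (r : ℝ) + 1) ^ 2 := by
    have h1 : 2 * r + 1 ≠ 0 := by omega
    have h2 : (2 * (r : ℝ) + 1) ≠ 0 := by exact_mod_cast h1
    positivity
  rw [abs_div]
  calc _ ≤ ((121 / 4) ^ (D + 1) * (2 * (4 ^ D * ((D + 1).factorial * D.factorial)))) /
        (30 * (2 * (r : ℝ) + 1) ^ 2 * (11 ^ (2 * D + 1) * ((D + 1).factorial * D.factorial))) := by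
        gcongr
        · exact abs_dualDenom_zero_le D
        · exact abs_dualDenom_outerNode_ge hr
    _ = _ := by
        have e : (11 : ℝ) ^ (2 * D + 1) = 121 ^ D * 11 := by rw [pow_succ, pow_mul]; norm_num
        rw [e, div_pow, pow_succ (121 : ℝ), pow_succ (4 : ℝ)]
        field_simp
        norm_num

/-- The total is at most `11 / 60 * 2 * (5 / 4) = 11 / 24`; the spacing `11` of the outer nodes is
what pushes it below `1 / 2`. -/
theorem sum_outer_weights_le (D : ℕ) :
    ∑ r ∈ Finset.Ico (-(D + 1 : ℕ) : ℤ) (D + 1 : ℕ),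
      |dualDenom (D + 1) 0 / dualDenom (D + 1) (outerNode r)| ≤ 1 / 2 := by
  refine (Finset.sum_le_sum fun r hr => abs_dualDenom_ratio_le hr).trans ?_
  rw [← Finset.mul_sum, sum_Ico_neg]
  have h : ∀ m : ℕ, 1 / (2 * (((m : ℤ) : ℝ)) + 1) ^ 2 + 1 / (2 * (((-1 - m : ℤ) : ℤ) : ℝ) + 1) ^ 2 =
      2 * (1 / (2 * (m : ℝ) + 1) ^ 2) := by
    intro m
    push_cast
    rw [show (2 * (-1 - (m : ℝ)) + 1) ^ 2 = (2 * (m : ℝ) + 1) ^ 2 by ring]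
    ring
  rw [Finset.sum_congr rfl fun m _ => h m, ← Finset.mul_sum]
  have h1 := sum_inv_odd_sq_le D
  have h2 : (0 : ℝ) ≤ 1 / (4 * ((D : ℝ) + 1)) := by positivity
  linarith

/-- Up to the factor `dualDenom D 0`, the sum is the coefficient of `X ^ (2 * D + 1)` in the
Lagrange interpolant of `p`, which is `p` itself. -/
theorem sum_dualDenom_eval (D : ℕ) {p : Polynomial ℝ} (hp : p.natDegree ≤ 2 * D) :
    ∑ e ∈ dualNodes D, dualDenom D 0 / dualDenom D e * p.eval (e : ℝ) = 0 := by
  have hd : p.degree < (dualNodes D).card := by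
    rw [card_dualNodes]
    exact lt_of_le_of_lt Polynomial.degree_le_natDegree (by exact_mod_cast by omega)
  have h := Lagrange.coeff_eq_sum (s := dualNodes D) (v := fun e : ℤ => (e : ℝ))
    (Int.cast_injective.injOn) hd
  rw [card_dualNodes, Polynomial.coeff_eq_zero_of_natDegree_lt (by omega)] at h
  have h' : ∑ e ∈ dualNodes D, p.eval (e : ℝ) / dualDenom D e = 0 := h.symm
  refine Eq.trans ?_ ((congrArg (dualDenom D 0 * ·) h').trans (mul_zero _))
  simp only [Finset.mul_sum]
  exact Finset.sum_congr rfl fun e _ => by ring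

/-- A weight function on `{0, …, 2h}` that annihilates polynomials of degree at most `2 * D`,
equals `1` at `h` and `-1` at `h - k`, and has total mass at most `1 / 2` elsewhere. -/
theorem exists_dual_weight {h k D : ℕ} (hk : 0 < k) (hD : 0 < D) (hle : 11 * k * D ≤ h) :
    ∃ ω : ℕ → ℝ, ω h = 1 ∧ ω (h - k) = -1 ∧ ∑ j ∈ Finset.range (2 * h + 1), |ω j| ≤ 5 / 2 ∧
      ∀ p : Polynomial ℝ, p.natDegree < 2 * D + 1 →
        ∑ j ∈ Finset.range (2 * h + 1), ω j * p.eval (j : ℝ) = 0 := by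
  obtain ⟨D, rfl⟩ : ∃ D', D = D' + 1 := ⟨D - 1, by omega⟩
  let ν : ℤ → ℝ := fun e => dualDenom (D + 1) 0 / dualDenom (D + 1) e
  let pos : ℤ → ℕ := fun e => (h + k * e : ℤ).toNat
  have hmem0 : (0 : ℤ) ∈ dualNodes (D + 1) := by simp [dualNodes]
  have hmem1 : (-1 : ℤ) ∈ dualNodes (D + 1) := by simp [dualNodes]
  -- All nodes lie in `[-11 * (D + 1), 11 * (D + 1)]`, so after scaling by `k` and centring at `h`
  -- they stay in `[0, 2 * h]`. This is where the bound on `11 * k * D` is spent.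
  have hrange : ∀ e ∈ dualNodes (D + 1), 0 ≤ (h + k * e : ℤ) ∧ (h + k * e : ℤ) ≤ 2 * h := by
    intro e he
    have hb : -(11 * (D + 1) : ℤ) ≤ e ∧ e ≤ 11 * (D + 1) := by
      clear hle
      simp only [dualNodes, Finset.mem_insert, Finset.mem_image, Finset.mem_Ico, outerNode] at he
      rcases he with rfl | rfl | ⟨r, hr, rfl⟩ <;> omega
    have hle' : (11 * k * (D + 1) : ℤ) ≤ h := by exact_mod_cast hle
    have hk' : (0 : ℤ) < k := by exact_mod_cast hk
    constructor <;> nlinarith [hb.1, hb.2]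
  have hpos : ∀ e ∈ dualNodes (D + 1), (pos e : ℤ) = h + k * e := fun e he =>
    Int.toNat_of_nonneg (hrange e he).1
  have hinj : ∀ e ∈ dualNodes (D + 1), ∀ e' ∈ dualNodes (D + 1), pos e = pos e' → e = e' := by
    intro e he e' he' heq
    have h1 : (k : ℤ) * e = k * e' := by
      have := hpos e he
      have := hpos e' he'
      rw [heq] at *
      linarith
    exact mul_left_cancel₀ (by exact_mod_cast hk.ne') h1
  have hposr : ∀ e ∈ dualNodes (D + 1), pos e ∈ Finset.range (2 * h + 1) := by
    intro e he
    have := hpos e he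
    have := hrange e he
    rw [Finset.mem_range]
    omega
  let ω : ℕ → ℝ := fun j => ∑ e ∈ dualNodes (D + 1), if pos e = j then ν e else 0
  have hω : ∀ e ∈ dualNodes (D + 1), ω (pos e) = ν e := by
    intro e he
    simp only [ω]
    rw [Finset.sum_eq_single_of_mem e he, if_pos rfl]
    intro e' he' hne
    exact if_neg fun hh => hne (hinj e' he' e he hh)
  have hp0 : pos 0 = h := by simp [pos]
  have hp1 : pos (-1) = h - k := by simp only [pos]; omega
  refine ⟨ω, ?_, ?_, ?_, ?_⟩
  · rw [← hp0, hω 0 hmem0]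
    exact div_self (dualDenom_zero_ne_zero _)
  · rw [← hp1, hω (-1) hmem1]
    simp only [ν]
    rw [dualDenom_neg_one, div_neg, div_self (dualDenom_zero_ne_zero _)]
  · have h1 : ∑ j ∈ Finset.range (2 * h + 1), |ω j| ≤ ∑ e ∈ dualNodes (D + 1), |ν e| := by
      calc _ ≤ ∑ j ∈ Finset.range (2 * h + 1), ∑ e ∈ dualNodes (D + 1),
            if pos e = j then |ν e| else 0 := by
            refine Finset.sum_le_sum fun j _ => (Finset.abs_sum_le_sum_abs _ _).trans_eq ?_
            exact Finset.sum_congr rfl fun e _ => by split_ifs <;> simp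
        _ = _ := by
            rw [Finset.sum_comm]
            refine Finset.sum_congr rfl fun e he => ?_
            rw [Finset.sum_ite_eq, if_pos (hposr e he)]
    refine h1.trans ?_
    rw [dualNodes, Finset.sum_insert, Finset.sum_insert, Finset.sum_image outerNode_injective.injOn]
    · have h2 := sum_outer_weights_le D
      have h3 : ν 0 = 1 := div_self (dualDenom_zero_ne_zero _)
      have h4 : ν (-1) = -1 := by
        simp only [ν]
        rw [dualDenom_neg_one, div_neg, div_self (dualDenom_zero_ne_zero _)]
      rw [h3, h4]
      rw [abs_one, abs_neg, abs_one]
      linarith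
    · simp only [Finset.mem_image, outerNode]; omega
    · simp only [Finset.mem_insert, Finset.mem_image, outerNode]; omega
  · intro p hp
    have hq : (p.comp (Polynomial.C (k : ℝ) * Polynomial.X + Polynomial.C (h : ℝ))).natDegree ≤
        2 * (D + 1) := by
      refine Polynomial.natDegree_comp_le.trans ?_
      calc _ ≤ p.natDegree * 1 := Nat.mul_le_mul_left _ Polynomial.natDegree_linear_le
        _ ≤ _ := by omega
    rw [← sum_dualDenom_eval (D + 1) hq]
    simp only [ω, Finset.sum_mul]
    rw [Finset.sum_comm]
    refine Finset.sum_congr rfl fun e he => ?_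
    simp only [ite_mul, zero_mul]
    rw [Finset.sum_ite_eq, if_pos (hposr e he)]
    have h2 : ((pos e : ℕ) : ℝ) = h + k * e := by exact_mod_cast congrArg (Int.cast (R := ℝ)) (hpos e he)
    rw [h2, Polynomial.eval_comp]
    simp [ν, add_comm]

end

noncomputable section

/-! ### Embedding the pattern matrix into the gap Hamming problem -/

/-- Positions of a string: blocks of four positions, and four groups of padding positions. -/
abbrev BlockPos (N h : ℕ) : Type :=
  (Fin (2 * h) × Bool × Bool) ⊕ Fin (N - h) ⊕ Fin (N - 3 * h) ⊕ Fin (N - h) ⊕ Fin (N - 3 * h)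

/-- In each block Alice writes two bits together with their complements. -/
def aliceString {N h : ℕ} (x : Fin (2 * h) × Bool → Bool) : BlockPos N h → Bool :=
  Sum.elim (fun p => xor (x (p.1, p.2.1)) p.2.2)
    (Sum.elim (fun _ => true) (Sum.elim (fun _ => true) (Sum.elim (fun _ => false) fun _ => false)))

/-- In each block Bob marks the position of one of Alice's bits or of its complement. -/
def bobString {N h : ℕ} (V w : Fin (2 * h) → Bool) : BlockPos N h → Bool :=
  Sum.elim (fun p => decide (p.2.1 = V p.1 ∧ p.2.2 = w p.1))
    (Sum.elim (fun _ => true) (Sum.elim (fun _ => false) (Sum.elim (fun _ => true) fun _ => false)))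

theorem card_blockPos {N h : ℕ} (hN : 3 * h ≤ N) : Fintype.card (BlockPos N h) = 4 * N := by
  simp only [Fintype.card_sum, Fintype.card_prod, Fintype.card_fin, Fintype.card_bool]
  omega

theorem card_filter_comp_equiv {α β : Type*} [Fintype α] [Fintype β] (e : α ≃ β) (P : β → Prop)
    [DecidablePred P] : (Finset.univ.filter fun i => P (e i)).card = ∑ b, if P b then 1 else 0 := by
  rw [Finset.card_filter]
  exact e.sum_comp fun b => if P b then 1 else 0

/-- Complementary pairs contribute `4 * h` ones whatever `x` is, and the padding adds `2 * N - 4 *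
h`. -/
theorem hammingWeight_aliceString {N h n : ℕ} (hN : 3 * h ≤ N) (e : Fin n ≃ BlockPos N h)
    (x : Fin (2 * h) × Bool → Bool) :
    hammingWeight (fun i => aliceString (N := N) x (e i)) = 2 * N := by
  rw [hammingWeight, card_filter_comp_equiv e fun b => aliceString x b = true]
  have h1 : ∀ i s, ((if aliceString (N := N) x (Sum.inl (i, s, true)) = true then 1 else 0) +
      if aliceString (N := N) x (Sum.inl (i, s, false)) = true then 1 else 0) = 1 := by
    intro i s
    rcases Bool.eq_false_or_eq_true (x (i, s)) with hb | hb <;> simp [aliceString, hb]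
  simp only [Fintype.sum_sum_type, Fintype.sum_prod_type, Fintype.sum_bool, h1]
  simp [aliceString]
  omega

theorem sum_bool_bool_eq (a b : Bool) (f : Bool → Bool → ℕ) :
    ∑ s, ∑ c, (if s = a ∧ c = b then f s c else 0) = f a b := by
  cases a <;> cases b <;> simp

theorem hammingWeight_bobString {N h n : ℕ} (hN : 3 * h ≤ N) (e : Fin n ≃ BlockPos N h)
    (V w : Fin (2 * h) → Bool) :
    hammingWeight (fun i => bobString (N := N) V w (e i)) = 2 * N := by
  rw [hammingWeight, card_filter_comp_equiv e fun b => bobString V w b = true]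
  simp only [Fintype.sum_sum_type, Fintype.sum_prod_type, bobString, Sum.elim_inl, Sum.elim_inr,
    decide_eq_true_eq, sum_bool_bool_eq _ _ fun _ _ => 1]
  simp
  omega

/-- The position marked in block `i` holds `x (i, V i)` xor `w i`; among the padding only the first
group, of size `N - h`, is shared. -/
theorem interCard_aliceString_bobString {N h n : ℕ} (e : Fin n ≃ BlockPos N h)
    (x : Fin (2 * h) × Bool → Bool) (V w : Fin (2 * h) → Bool) :
    interCard (fun i => aliceString (N := N) x (e i)) (fun i => bobString (N := N) V w (e i)) =
      hammingWeight (fun i => xor (x (i, V i)) (w i)) + (N - h) := by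
  rw [interCard, card_filter_comp_equiv e fun b => aliceString x b = true ∧ bobString V w b = true]
  simp only [Fintype.sum_sum_type, Fintype.sum_prod_type, bobString, aliceString, Sum.elim_inl,
    Sum.elim_inr, decide_eq_true_eq]
  have h1 : ∀ i, ∑ s, ∑ c, (if xor (x (i, s)) c = true ∧ s = V i ∧ c = w i then 1 else 0) =
      if xor (x (i, V i)) (w i) = true then 1 else 0 := by
    intro i
    rw [← sum_bool_bool_eq (V i) (w i) fun s c => if xor (x (i, s)) c = true then 1 else 0]
    refine Finset.sum_congr rfl fun s _ => Finset.sum_congr rfl fun c _ => ?_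
    rw [← ite_and]
    exact if_congr and_comm rfl rfl
  rw [hammingWeight, Finset.card_filter, ← Finset.sum_congr rfl fun i _ => h1 i]
  simp

/-- The symmetric lift of a dual weight detects the difference between weight `h` and weight
`h - k`. -/
theorem sum_symmetrized_mul_ge {h k : ℕ} (hk : 0 < k) (hkh : k ≤ h) {ω : ℕ → ℝ} (h1 : ω h = 1)
    (h2 : ω (h - k) = -1) (h3 : ∑ j ∈ Finset.range (2 * h + 1), |ω j| ≤ 5 / 2)
    {g : (Fin (2 * h) → Bool) → ℝ} (g0 : ∀ z, 0 ≤ g z) (g1 : ∀ z, g z ≤ 1)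
    (gh : ∀ z, hammingWeight z = h → 9 / 10 ≤ g z)
    (gk : ∀ z, hammingWeight z = h - k → g z ≤ 1 / 10) :
    3 / 10 ≤ ∑ z : Fin (2 * h) → Bool,
      ω (hammingWeight z) / (2 * h).choose (hammingWeight z) * g z := by
  -- A layerwise lower bound for `ω * g`, with values at least `9 / 10` at `h`, `-1 / 10` at `h - k`
  -- and `-|ω|` elsewhere. Its sum is at least `19 / 10 + 9 / 10 - 5 / 2 = 3 / 10`.
  let φ : ℕ → ℝ := fun j => (if j = h then 19 / 10 else 0) + (if j = h - k then 9 / 10 else 0) - |ω j|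
  have hφ : ∀ z, φ (hammingWeight z) ≤ ω (hammingWeight z) * g z := by
    intro z
    have hlt : h - k ≠ h := by omega
    simp only [φ]
    by_cases e1 : hammingWeight z = h
    · have := gh z e1
      rw [e1, if_pos rfl, if_neg hlt.symm, h1, abs_one]
      linarith
    · by_cases e2 : hammingWeight z = h - k
      · have := gk z e2
        rw [e2, if_neg hlt, if_pos rfl, h2, abs_neg, abs_one]
        linarith
      · rw [if_neg e1, if_neg e2]
        have h4 : |ω (hammingWeight z) * g z| ≤ |ω (hammingWeight z)| := by
          rw [abs_mul, abs_of_nonneg (g0 z)]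
          exact mul_le_of_le_one_right (abs_nonneg _) (g1 z)
        have := (abs_le.1 h4).1
        linarith
  have hsum : 3 / 10 ≤ ∑ j ∈ Finset.range (2 * h + 1), φ j := by
    simp only [φ, Finset.sum_sub_distrib, Finset.sum_add_distrib, Finset.sum_ite_eq']
    rw [if_pos (by rw [Finset.mem_range]; omega), if_pos (by rw [Finset.mem_range]; omega)]
    linarith
  rw [← sum_symmetrized] at hsum
  refine hsum.trans (Finset.sum_le_sum fun z _ => ?_)
  rw [div_mul_eq_mul_div]
  gcongr
  exact hφ z

/-- Exponential lower bound on `4 ^ q` for protocols that distinguish intersection sizes `N` and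
`N - k`. -/
theorem two_pow_le_of_computes {N h k D : ℕ} (hN : 3 * h ≤ N) (hk : 0 < k) (hD : 0 < D)
    (hle : 11 * k * D ≤ h) {F : (Fin (4 * N) → Bool) → (Fin (4 * N) → Bool) → Option Bool}
    (hF1 : ∀ x y, hammingWeight x = 2 * N → hammingWeight y = 2 * N → interCard x y = N →
      F x y = some true)
    (hF0 : ∀ x y, hammingWeight x = 2 * N → hammingWeight y = 2 * N → interCard x y = N - k →
      F x y = some false)
    (P : EntangledProtocol (Fin (4 * N) → Bool) (Fin (4 * N) → Bool)) (hP : P.Computes F (1 / 10)) :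
    (2 : ℝ) ^ D ≤ 16 * 4 ^ P.protocol.cost := by
  have hkh : k ≤ h := by nlinarith
  obtain ⟨ω, hω1, hω2, hω3, hω4⟩ := exists_dual_weight hk hD hle
  obtain ⟨κ, hκ, ν, hν, u, v, hcard, hu, hv, hp⟩ := P.exists_inner_eq true
  let e : Fin (4 * N) ≃ BlockPos N h :=
    Fintype.equivOfCardEq (by rw [card_blockPos hN, Fintype.card_fin])
  let A : (Fin (2 * h) × Bool → Bool) → Fin (4 * N) → Bool := fun x i => aliceString x (e i)
  let B : (Fin (2 * h) → Bool) → (Fin (2 * h) → Bool) → Fin (4 * N) → Bool :=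
    fun V w i => bobString V w (e i)
  let ψ : (Fin (2 * h) → Bool) → ℝ := fun z =>
    ω (hammingWeight z) / (2 * h).choose (hammingWeight z)
  let p : (Fin (2 * h) × Bool → Bool) → (Fin (2 * h) → Bool) → (Fin (2 * h) → Bool) → ℝ :=
    fun x V w => P.protocol.outputProb (A x) (B V w) true P.init
  have hAw : ∀ x, hammingWeight (A x) = 2 * N := hammingWeight_aliceString hN e
  have hBw : ∀ V w, hammingWeight (B V w) = 2 * N := hammingWeight_bobString hN e
  have hAB : ∀ x V w, interCard (A x) (B V w) =
      hammingWeight (fun i => xor (x (i, V i)) (w i)) + (N - h) :=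
    interCard_aliceString_bobString e
  have hadd : ∀ x y, P.protocol.outputProb x y true P.init + P.protocol.outputProb x y false P.init
      = 1 := fun x y => (P.protocol.outputProb_add x y P.init).trans P.init_normSq
  have lower : ∀ V x, 3 / 10 ≤ ∑ w, ψ (fun i => xor (x (i, V i)) (w i)) * p x V w := by
    intro V x
    -- For fixed `x` and `V`, the pattern runs through the whole cube as `w` does, so the sum over
    -- `w` is a sum over patterns.
    have hinv : Function.Involutive fun (w : Fin (2 * h) → Bool) i => xor (x (i, V i)) (w i) := by
      intro w; funext i; simp
    have hg := sum_symmetrized_mul_ge hk hkh hω1 hω2 hω3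
      (g := fun z => p x V fun i => xor (x (i, V i)) (z i))
      (fun z => P.protocol.outputProb_nonneg _ _ _ _)
      (fun z => by
        have h1 := hadd (A x) (B V fun i => xor (x (i, V i)) (z i))
        have h2 := P.protocol.outputProb_nonneg (A x) (B V fun i => xor (x (i, V i)) (z i)) false
          P.init
        simp only [p]; linarith)
      (fun z hz => by
        have h1 := hP _ _ _ (hF1 (A x) (B V fun i => xor (x (i, V i)) (z i)) (hAw x) (hBw _ _) (by
          rw [hAB, show (fun i => xor (x (i, V i)) (xor (x (i, V i)) (z i))) = z from hinv z, hz]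
          omega))
        simp only [p]; linarith)
      (fun z hz => by
        have h1 := hP _ _ _ (hF0 (A x) (B V fun i => xor (x (i, V i)) (z i)) (hAw x) (hBw _ _) (by
          rw [hAB, show (fun i => xor (x (i, V i)) (xor (x (i, V i)) (z i))) = z from hinv z, hz]
          omega))
        have h2 := hadd (A x) (B V fun i => xor (x (i, V i)) (z i))
        simp only [p]; linarith)
    rw [← Equiv.sum_comp (hinv.toPerm _)] at hg
    refine hg.trans_eq (Finset.sum_congr rfl fun w _ => ?_)
    have : (fun i => xor (x (i, V i)) ((hinv.toPerm _) w i)) = w := hinv w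
    rw [this]
    rfl
  have lower' : 3 / 10 * (8 : ℝ) ^ (2 * h) ≤
      ∑ V, ∑ w, ∑ x, ψ (fun i => xor (x (i, V i)) (w i)) * p x V w := by
    calc 3 / 10 * (8 : ℝ) ^ (2 * h) =
        ∑ _V : Fin (2 * h) → Bool, ∑ _x : Fin (2 * h) × Bool → Bool, (3 / 10 : ℝ) := by
          simp only [Finset.sum_const, Finset.card_univ, Fintype.card_fun, Fintype.card_prod,
            Fintype.card_bool, Fintype.card_fin, nsmul_eq_mul]
          push_cast
          rw [mul_comm (2 * h) 2, pow_mul 2 2 (2 * h), ← mul_assoc, ← mul_pow]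
          norm_num
          ring
      _ ≤ ∑ V, ∑ x, ∑ w, ψ (fun i => xor (x (i, V i)) (w i)) * p x V w :=
          Finset.sum_le_sum fun V _ => Finset.sum_le_sum fun x _ => lower V x
      _ = _ := Finset.sum_congr rfl fun V _ => Finset.sum_comm
  let _ : InnerProductSpace ℝ (EuclideanSpace ℂ ν) := InnerProductSpace.rclikeToReal ℂ _
  have upper : ∀ i, ∑ V, ∑ w, ∑ x, ψ (fun i => xor (x (i, V i)) (w i)) *
      inner ℝ (u i (A x)) (v i (B V w)) ≤ 8 ^ (2 * h) * (5 / 2) / 2 ^ D := by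
    intro i
    -- With `d = 2 * D + 1`, the square root of `2 ^ d` is at least `2 ^ D`.
    have hb := pattern_matrix_bound (ψ := ψ) (C := 5 / 2) (d := 2 * D + 1)
      (fun S => (abs_sum_symmetrized_walsh_le ω S).trans hω3)
      (fun S hS => sum_symmetrized_walsh_eq_zero hω4 S hS)
      (u := fun x => u i (A x)) (v := fun V w => v i (B V w)) (fun x => hu _ _) (fun V w => hv _ _)
    refine le_of_sq_le_sq (hb.trans ?_) (by positivity)
    have e1 : (64 : ℝ) ^ (2 * h) = (8 ^ (2 * h)) ^ 2 := by
      rw [pow_right_comm]; norm_num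
    rw [Fintype.card_fin, div_pow _ ((2 : ℝ) ^ D), mul_pow, ← e1, ← pow_mul, mul_comm D 2]
    gcongr <;> norm_num
  have hexp : ∀ x V w, p x V w = ∑ i, inner ℝ (u i (A x)) (v i (B V w)) := fun x V w => hp _ _
  have htotal : ∑ V, ∑ w, ∑ x, ψ (fun i => xor (x (i, V i)) (w i)) * p x V w =
      ∑ i, ∑ V, ∑ w, ∑ x, ψ (fun i => xor (x (i, V i)) (w i)) *
        inner ℝ (u i (A x)) (v i (B V w)) := by
    simp only [hexp, Finset.mul_sum]
    rw [Finset.sum_comm (s := (Finset.univ : Finset κ))]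
    refine Finset.sum_congr rfl fun V _ => ?_
    rw [Finset.sum_comm (s := (Finset.univ : Finset κ))]
    exact Finset.sum_congr rfl fun w _ => Finset.sum_comm
  rw [htotal] at lower'
  have h1 := lower'.trans (Finset.sum_le_sum fun i _ => upper i)
  rw [Finset.sum_const, Finset.card_univ, hcard, nsmul_eq_mul] at h1
  push_cast at h1
  have h8 : (0 : ℝ) < 8 ^ (2 * h) := by positivity
  have h2D : (0 : ℝ) < 2 ^ D := by positivity
  have h4 : (0 : ℝ) < 4 ^ P.protocol.cost := by positivity
  rw [← mul_div_assoc, le_div_iff₀ h2D] at h1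
  have h2 : 8 ^ (2 * h) * (3 / 10 * (2 : ℝ) ^ D) ≤ 8 ^ (2 * h) * (4 ^ P.protocol.cost * (5 / 2)) := by
    linarith
  have h3 := le_of_mul_le_mul_left h2 h8
  linarith

end

noncomputable section

/-! ### The lower bound -/

theorem card_filter_fin_between {n a b : ℕ} (hb : b ≤ n) :
    (Finset.univ.filter fun i : Fin n => a ≤ i.1 ∧ i.1 < b).card = b - a := by
  rw [← Nat.card_Ico, ← Finset.card_map Fin.valEmbedding]
  congr 1
  ext i
  simp only [Finset.mem_map, Finset.mem_filter, Finset.mem_univ, true_and, Fin.valEmbedding_apply,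
    Finset.mem_Ico]
  constructor
  · rintro ⟨j, hj, rfl⟩; exact hj
  · intro hi; exact ⟨⟨i, by omega⟩, hi, rfl⟩

/-- The indicator string of the positions in `[a, b)`. -/
def intervalString (n a b : ℕ) : Fin n → Bool := fun i => decide (a ≤ i.1 ∧ i.1 < b)

theorem hammingWeight_intervalString {n a b : ℕ} (hb : b ≤ n) :
    hammingWeight (intervalString n a b) = b - a := by
  simp only [hammingWeight, intervalString, decide_eq_true_eq]
  exact card_filter_fin_between hb

theorem interCard_intervalString {n a b c d : ℕ} (hac : a ≤ c) (hbd : b ≤ d) (hb : b ≤ n) :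
    interCard (intervalString n a b) (intervalString n c d) = b - c := by
  simp only [interCard, intervalString, decide_eq_true_eq]
  rw [← card_filter_fin_between hb]
  congr 1
  ext i
  simp only [Finset.mem_filter, Finset.mem_univ, true_and]
  omega

theorem interCard_comm {n : ℕ} (x y : Fin n → Bool) : interCard x y = interCard y x := by
  simp only [interCard, and_comm]

/-- A silent protocol ignores one of the inputs, yet both the row of `x` and the column of `y`
contain instances with opposite answers. -/
theorem cost_ne_zero_of_computes {X Y : Type} {F : X → Y → Option Bool} {P : EntangledProtocol X Y}
    (hP : P.Computes F (1 / 10)) {x x₁ x₂ : X} {y y₁ y₂ : Y} (h1 : F x y₁ = some true)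
    (h2 : F x y₂ = some false) (h3 : F x₁ y = some true) (h4 : F x₂ y = some false) :
    P.protocol.cost ≠ 0 := by
  intro h0
  have hadd : ∀ x y, P.protocol.outputProb x y true P.init + P.protocol.outputProb x y false P.init
      = 1 := fun x y => (P.protocol.outputProb_add x y P.init).trans P.init_normSq
  rcases P.protocol.outputProb_congr_of_cost_eq_zero h0 true P.init with h | h
  · have a1 := hP _ _ _ h1
    have a2 := hP _ _ _ h2
    have a3 := hadd x y₂
    rw [h x y₁ y₂] at a1
    linarith
  · have a1 := hP _ _ _ h3
    have a2 := hP _ _ _ h4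
    have a3 := hadd x₂ y
    rw [h x₁ x₂ y] at a1
    linarith

theorem promisedGHD_eq_true {N : ℕ} {κ : ℝ} {x y : Fin (4 * N) → Bool}
    (hx : hammingWeight x = 2 * N) (hy : hammingWeight y = 2 * N) (h : interCard x y = N) :
    promisedGHD (4 * N) κ x y = some true := by
  rw [promisedGHD, if_pos, if_pos]
  · rw [h]; push_cast; ring
  · rw [hx, hy]; push_cast; constructor <;> ring

theorem promisedGHD_eq_false {N k : ℕ} {κ : ℝ} {x y : Fin (4 * N) → Bool} (hk : 0 < k) (hkN : k ≤ N)
    (h1 : ghdBeta (4 * N) / 2 ≤ k) (h2 : (k : ℝ) ≤ κ * ghdBeta (4 * N) / 2)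
    (hx : hammingWeight x = 2 * N) (hy : hammingWeight y = 2 * N) (h : interCard x y = N - k) :
    promisedGHD (4 * N) κ x y = some false := by
  have hk' : (0 : ℝ) < k := by exact_mod_cast hk
  have h4 : (((4 * N : ℕ) : ℝ)) / 4 = N := by push_cast; ring
  rw [promisedGHD, if_pos, if_neg, if_pos]
  · rw [h, h4, Nat.cast_sub hkN]
    constructor <;> linarith
  · rw [h, h4, Nat.cast_sub hkN]
    intro h5
    linarith
  · rw [hx, hy]; push_cast; constructor <;> ring

theorem ghdBeta_half_le (n : ℕ) : ghdBeta n / 2 ≤ √(n : ℝ) / 11 := by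
  have h : ghdBeta n ≤ √(n : ℝ) * (2 / 11) := by
    rw [ghdBeta]
    refine Real.sqrt_le_iff.2 ⟨by positivity, ?_⟩
    rw [mul_pow, Real.sq_sqrt (Nat.cast_nonneg n)]
    have := Nat.cast_nonneg (α := ℝ) n
    linarith
  linarith

theorem le_ghdBeta_half (n : ℕ) : √(n : ℝ) / 12 ≤ ghdBeta n / 2 := by
  have h : √(n : ℝ) * (1 / 6) ≤ ghdBeta n := by
    rw [ghdBeta]
    refine Real.le_sqrt_of_sq_le ?_
    rw [mul_pow, Real.sq_sqrt (Nat.cast_nonneg n)]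
    have := Nat.cast_nonneg (α := ℝ) n
    linarith
  linarith

theorem sqrt_le_cost {N k : ℕ} {κ : ℝ} (hN : 0 < N) (hkN : k ≤ N)
    (h1 : ghdBeta (4 * N) / 2 ≤ k) (h2 : (k : ℝ) ≤ κ * ghdBeta (4 * N) / 2)
    (h3 : (k : ℝ) ≤ ghdBeta (4 * N) / 2 + 1)
    (P : EntangledProtocol (Fin (4 * N) → Bool) (Fin (4 * N) → Bool))
    (hP : P.Computes (promisedGHD (4 * N) κ) (1 / 10)) :
    1 / 600 * √((4 * N : ℕ) : ℝ) ≤ P.protocol.cost := by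
  set q := P.protocol.cost with hq
  set s := √((4 * N : ℕ) : ℝ) with hs
  have hss : s ^ 2 = 4 * N := by
    rw [hs, Real.sq_sqrt (Nat.cast_nonneg _)]; push_cast; ring
  have hN1 : (1 : ℝ) ≤ N := by exact_mod_cast hN
  have hs2 : 2 ≤ s := Real.le_sqrt_of_sq_le (by push_cast; linarith)
  have hk : 0 < k := by
    have := le_ghdBeta_half (4 * N)
    have h4 : (0 : ℝ) < k := by linarith
    exact_mod_cast h4
  have hx : ∀ j, j ≤ 2 * N →
      hammingWeight (intervalString (4 * N) (2 * N - j) (4 * N - j)) = 2 * N := by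
    intro j hj
    rw [hammingWeight_intervalString (by omega)]; omega
  have hxy : ∀ j, j ≤ 2 * N → interCard (intervalString (4 * N) 0 (2 * N))
      (intervalString (4 * N) (2 * N - j) (4 * N - j)) = j := by
    intro j hj
    rw [interCard_intervalString (by omega) (by omega) (by omega)]; omega
  have h0 : hammingWeight (intervalString (4 * N) 0 (2 * N)) = 2 * N := by
    rw [hammingWeight_intervalString (by omega)]; omega
  have hq0 : q ≠ 0 := by
    refine cost_ne_zero_of_computes hP
      (promisedGHD_eq_true h0 (hx N (by omega)) (hxy N (by omega)))
      (promisedGHD_eq_false hk hkN h1 h2 h0 (hx (N - k) (by omega)) (hxy (N - k) (by omega)))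
      (promisedGHD_eq_true (hx N (by omega)) h0 ?_)
      (promisedGHD_eq_false hk hkN h1 h2 (hx (N - k) (by omega)) h0 ?_)
    · rw [interCard_comm]; exact hxy N (by omega)
    · rw [interCard_comm]; exact hxy (N - k) (by omega)
  have hq1 : (1 : ℝ) ≤ q := by exact_mod_cast Nat.one_le_iff_ne_zero.2 hq0
  -- The largest `h` for which the padding fits, and below it the largest `D` with `11 * k * D ≤ h`.
  -- If `D = 0`, the bound on `D` is trivial.
  obtain ⟨h, hh⟩ : ∃ h, h = N / 3 := ⟨_, rfl⟩
  obtain ⟨D, hD⟩ : ∃ D, D = h / (11 * k) := ⟨_, rfl⟩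
  have hDq : D ≤ 2 * q + 4 := by
    rcases Nat.eq_zero_or_pos D with hD0 | hD0
    · omega
    have hle : 11 * k * D ≤ h := by rw [hD]; exact Nat.mul_div_le _ _
    have hpow := two_pow_le_of_computes (by omega) hk hD0 hle
      (fun x y hx hy hxy => promisedGHD_eq_true hx hy hxy)
      (fun x y hx hy hxy => promisedGHD_eq_false hk hkN h1 h2 hx hy hxy) P hP
    have e : (16 : ℝ) * 4 ^ P.protocol.cost = 2 ^ (2 * q + 4) := by
      rw [pow_add, pow_mul, hq]; norm_num; ring
    rw [e] at hpow
    exact (pow_le_pow_iff_right₀ (by norm_num)).1 hpow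
  have hlt : h < 11 * k * (D + 1) := by
    rw [hD]; exact Nat.lt_mul_div_succ h (by omega)
  -- Since `q ≥ 1`, `D + 1 ≤ 2 * q + 5 ≤ 7 * q`, and `77 = 11 * 7`.
  have hmul : h ≤ 77 * (k * q) := by
    have : D + 1 ≤ 7 * q := by omega
    nlinarith
  have hNh : (N : ℝ) ≤ 3 * (77 * (k * q)) + 2 := by
    have : N ≤ 3 * (77 * (k * q)) + 2 := by omega
    exact_mod_cast this
  have hks : (k : ℝ) ≤ s / 11 + 1 := h3.trans (by have := ghdBeta_half_le (4 * N); linarith)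
  have hkq : (k : ℝ) * q ≤ (s / 11 + 1) * q := mul_le_mul_of_nonneg_right hks (by linarith)
  -- Here `s ^ 2 = 4 * N ≤ 924 * k * q + 8 ≤ 84 * s * q + 924 * q + 8`; by `s ≥ 2` and `q ≥ 1` this
  -- is at most `550 * s * q`.
  have hsq : s * s ≤ 600 * q * s := by nlinarith
  have := le_of_mul_le_mul_right hsq (by linarith)
  linarith

theorem sqrt_le_quantumCC {N k : ℕ} {κ : ℝ} (hN : 0 < N) (hkN : k ≤ N)
    (h1 : ghdBeta (4 * N) / 2 ≤ k) (h2 : (k : ℝ) ≤ κ * ghdBeta (4 * N) / 2)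
    (h3 : (k : ℝ) ≤ ghdBeta (4 * N) / 2 + 1) :
    ENNReal.ofReal (1 / 600 * √((4 * N : ℕ) : ℝ)) ≤
      (quantumCC (promisedGHD (4 * N) κ) (1 / 10) : ℝ≥0∞) := by
  set r := 1 / 600 * √((4 * N : ℕ) : ℝ) with hr
  have hle : ((⌈r⌉₊ : ℕ) : ℕ∞) ≤ quantumCC (promisedGHD (4 * N) κ) (1 / 10) :=
    le_iInf₂ fun P hP => by
      exact_mod_cast Nat.ceil_le.2 (sqrt_le_cost hN hkN h1 h2 h3 P hP)
  calc ENNReal.ofReal r ≤ ENNReal.ofReal (⌈r⌉₊ : ℝ) := ENNReal.ofReal_le_ofReal (Nat.le_ceil r)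
    _ = (((⌈r⌉₊ : ℕ) : ℕ∞) : ℝ≥0∞) := by simp
    _ ≤ _ := ENat.toENNReal_le.2 hle

end

theorem theorem3 :
    ∃ c : ℝ, 0 < c ∧
      (∀ κ : ℝ, 1 < κ → ∃ N : ℕ, ∀ n : ℕ, N ≤ n → 4 ∣ n →
        ENNReal.ofReal (c * √(n : ℝ)) ≤ (quantumCC (promisedGHD n κ) (1 / 10) : ℝ≥0∞)) ∧
      (∀ (n : ℕ) (κ : ℝ), 4 ∣ n → 1 < κ →
        (∃ x y : Fin n → Bool, promisedGHD n κ x y = some false) →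
        ENNReal.ofReal (c * √(n : ℝ)) ≤ (quantumCC (promisedGHD n κ) (1 / 10) : ℝ≥0∞)) := by
  refine ⟨1 / 600, by norm_num, ?_, ?_⟩
  · intro κ hκ
    -- From `√n ≥ 12 / (κ - 1)` the interval `[β / 2, κβ / 2]` has length at least `1`, so it
    -- contains `⌈β / 2⌉`. The summand `8` excludes degenerate `n`.
    refine ⟨⌈(12 / (κ - 1)) ^ 2⌉₊ + 8, ?_⟩
    rintro n hn ⟨N, rfl⟩
    have hκ' : 0 < κ - 1 := by linarith
    have hβ0 : 0 ≤ ghdBeta (4 * N) := Real.sqrt_nonneg _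
    have hlow := le_ghdBeta_half (4 * N)
    have hup := ghdBeta_half_le (4 * N)
    have hceil := Nat.ceil_lt_add_one (show 0 ≤ ghdBeta (4 * N) / 2 by positivity)
    have hN2 : (2 : ℝ) ≤ N := by exact_mod_cast (show 2 ≤ N by omega)
    have hlarge : 12 / (κ - 1) ≤ √((4 * N : ℕ) : ℝ) := by
      refine Real.le_sqrt_of_sq_le ((Nat.le_ceil _).trans ?_)
      exact_mod_cast (by omega)
    refine sqrt_le_quantumCC (k := ⌈ghdBeta (4 * N) / 2⌉₊) (by omega) ?_ (Nat.le_ceil _) ?_ hceil.le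
    · refine Nat.ceil_le.2 (hup.trans ?_)
      have hs : √((4 * N : ℕ) : ℝ) ≤ 4 * N := by
        refine Real.sqrt_le_iff.2 ⟨by positivity, ?_⟩
        push_cast
        nlinarith
      linarith
    · rw [div_le_iff₀ hκ'] at hlarge
      nlinarith
  · rintro n κ ⟨N, rfl⟩ hκ ⟨x, y, hxy⟩
    rcases Nat.eq_zero_or_pos N with rfl | hN
    · simp
    have h4 : (((4 * N : ℕ) : ℝ)) / 4 = N := by push_cast; ring
    have hβ0 : 0 ≤ ghdBeta (4 * N) := Real.sqrt_nonneg _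
    have hceil := Nat.ceil_lt_add_one (show 0 ≤ ghdBeta (4 * N) / 2 by positivity)
    obtain ⟨hl, hu⟩ : (interCard x y : ℝ) ∈ Set.Icc ((N : ℝ) - κ * ghdBeta (4 * N) / 2)
        ((N : ℝ) - ghdBeta (4 * N) / 2) := by
      rw [promisedGHD, h4] at hxy
      split_ifs at hxy with a b c
      · simp at hxy
      · exact c
    have hle : interCard x y ≤ N := by
      have : (interCard x y : ℝ) ≤ N := by linarith
      exact_mod_cast this
    -- The given pair has an integral deficit `N - interCard x y` in `[β / 2, κβ / 2]`, so the
    -- smallest integer `⌈β / 2⌉` above the left end also lies there.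
    have hk : ⌈ghdBeta (4 * N) / 2⌉₊ ≤ N - interCard x y :=
      Nat.ceil_le.2 (by rw [Nat.cast_sub hle]; linarith)
    have hk' : (⌈ghdBeta (4 * N) / 2⌉₊ : ℝ) ≤ N - interCard x y := by
      rw [← Nat.cast_sub hle]; exact_mod_cast hk
    exact sqrt_le_quantumCC (k := ⌈ghdBeta (4 * N) / 2⌉₊) hN (by omega) (Nat.le_ceil _)
      (by linarith) hceil.le
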